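/- Let $K$ be a field of positive characteristic $p$. For $n\ge 1$ define Lie algebras $A_n$, $B_n$, $C_n$ over $K$ as follows. The space $A_n$ has as basis the symbols $a^{(k)}_{\sigma s}$, where $0\le s\le p$, $\sigma\subseteq\{1,\dots,2n-1\}$ and either $k=1$, or $2\le k\le p-1$ and $|\sigma|$ is odd, or $k=p$ and $\sigma=\{1,\dots,2n-1\}$; symbols $a^{(k)}_{\sigma s}$ with other labels denote $0$. The multiplication is $$a^{(k)}_{\sigma s}a^{(l)}_{\tau t}=(-1)^{|\sigma|}a^{(k+l)}_{\sigma\cup\tau,\,s+t}$$ if $k+l\le p$, $s+t\le p$, $\sigma\cap\tau=\varnothing$ and $|\sigma|+|\tau|$ is odd, and $a^{(k)}_{\sigma s}a^{(l)}_{\tau t}=0$ otherwise. For $\lambda,\mu\subseteq\{1,\dots,2n-1\}$ with $|\lambda|$ odd and $|\mu|$ even and for $0\le t\le p$ let $g_{\lambda t}$, $h_{\mu t}$ be the derivations of $A_n$ (acting on the right) given by $$a^{(k)}_{\sigma s}g_{\lambda t}=a^{(k)}_{\sigma\cup\lambda,\,s+t}\ \text{ if } s+t\le p,\ \sigma\cap\lambda=\varnothing,\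 |\sigma| \text{ even},\qquad a^{(k)}_{\sigma s}h_{\mu t}=k\,a^{(k)}_{\sigma\cup\mu,\,s+t}\ \text{ if } s+t\le p,\ \sigma\cap\mu=\varnothing,$$ and $a^{(k)}_{\sigma s}g_{\lambda t}=0$, $a^{(k)}_{\sigma s}h_{\mu t}=0$ in all other cases. Let $B_n$ be the split extension of $A_n$ by the abelian Lie algebra of derivations generated by all $g_{\lambda t}$, $h_{\mu t}$, and let $C_n$ be the subalgebra of $B_n$ generated by $a^{(1)}_{\varnothing 0}$, $g_{\{1\}0}$, $h_{\varnothing 1}$ and $h_{\{2j,2j+1\}0}$ for $1\le j\le n-1$. Let $r_1,r_2,r_3,\dots$ be any enumeration without repetition of the rational numbers and put $L_r=C_m$ for $r=r_m$. For real $\alpha$ let $\mathfrak W_\alpha=\operatorname{var}\{L_r\mid r\in\mathbb Q,\ r\le\alpha\}$ be the variety of Lie algebras over $K$ generated by these algebras. **Theorem 2.** Every variety $\mathfrak W_\alpha$ is locally finite (each of its finitely generated algebras is finite-dimensional over $K$), and $\mathfrak W_\alpha\subsetneq\mathfrak W_\beta$ whenever $\alpha<\beta$. In particular, over any field of positive characteristic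 there is a continuum of locally finite varieties of Lie algebras which form a strictly increasing chain under inclusion. -/

import Mathlib

universe u

/-! ### Varieties of Lie algebras -/

/-- `f = 0` is an identity of the Lie algebra `L`: the Lie polynomial `f` in the variables
`x₀, x₁, …` vanishes under every substitution of elements of `L` for the variables. -/
def IsLieIdentity (K : Type u) [Field K] (L : Type u) [LieRing L] [LieAlgebra K L]
    (f : FreeLieAlgebra K ℕ) : Prop :=
  ∀ v : ℕ → L, FreeLieAlgebra.lift K v f = 0

/-- A variety of Lie algebras over `K`: the class of all Lie algebras over `K` that satisfy
some given set of identities. -/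
@[ext]
structure LieVariety (K : Type u) [Field K] where
  /-- The Lie algebra `L` belongs to the variety. -/
  Mem : ∀ (L : Type u) [LieRing L] [LieAlgebra K L], Prop
  exists_identities : ∃ I : Set (FreeLieAlgebra K ℕ),
    ∀ (L : Type u) [LieRing L] [LieAlgebra K L], Mem L ↔ ∀ f ∈ I, IsLieIdentity K L f

namespace LieVariety

variable {K : Type u} [Field K]

/-- Varieties are ordered by inclusion. -/
instance : PartialOrder (LieVariety K) where
  le V W := ∀ (L : Type u) [LieRing L] [LieAlgebra K L], V.Mem L → W.Mem L
  le_refl _ _ _ _ h := h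
  le_trans _ _ _ h₁ h₂ L _ _ h := h₂ L (h₁ L h)
  le_antisymm V W h₁ h₂ := by
    ext L _ _
    exact ⟨h₁ L, h₂ L⟩

/-- `var {Lᵢ | i ∈ ι}`, the variety generated by a family of Lie algebras: the class of all Lie
algebras that satisfy every identity common to all the `Lᵢ`. -/
def generatedBy (K : Type u) [Field K] {ι : Type*} (L : ι → Type u)
    [∀ i, LieRing (L i)] [∀ i, LieAlgebra K (L i)] : LieVariety K where
  Mem M _ _ := ∀ f : FreeLieAlgebra K ℕ, (∀ i, IsLieIdentity K (L i) f) → IsLieIdentity K M f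
  exists_identities := ⟨{f | ∀ i, IsLieIdentity K (L i) f}, fun _ _ _ => Iff.rfl⟩

/-- A variety is locally finite if each of its finitely generated algebras is
finite-dimensional. -/
def IsLocallyFinite (V : LieVariety K) : Prop :=
  ∀ (L : Type u) [LieRing L] [LieAlgebra K L], V.Mem L →
    (∃ S : Finset L, LieSubalgebra.lieSpan K L (S : Set L) = ⊤) → FiniteDimensional K L

end LieVariety

/-! ### The Lie algebras `A_n`, `B_n`, `C_n` -/

namespace Drensky

/-- The labels `(k, σ, s)` of the basis of `A_n`: here `1 ≤ k ≤ p`, `0 ≤ s ≤ p` and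
`σ ⊆ {1, …, 2n-1}`; for `k ≥ 2` the set `σ` has an odd number of elements; for `k = p` only
`σ = {1, …, 2n-1}` is left. -/
def IsLabel (p n k : ℕ) (σ : Finset ℕ) (s : ℕ) : Prop :=
  1 ≤ k ∧ k ≤ p ∧ s ≤ p ∧ σ ⊆ Finset.Icc 1 (2 * n - 1) ∧ (2 ≤ k → Odd σ.card) ∧
    (k = p → σ = Finset.Icc 1 (2 * n - 1))

/-- The index set of the basis of `A_n`. -/
abbrev Label (p n : ℕ) : Type :=
  {i : ℕ × Finset ℕ × ℕ // IsLabel p n i.1 i.2.1 i.2.2}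

/-- The vector space `A_n` over `K`, with basis `Label p n`. -/
def A (K : Type u) [Field K] (p n : ℕ) : Type u := Label p n →₀ K

section

variable (K : Type u) [Field K] (p n : ℕ)

noncomputable instance : AddCommGroup (A K p n) := inferInstanceAs (AddCommGroup (Label p n →₀ K))

noncomputable instance : Module K (A K p n) := inferInstanceAs (Module K (Label p n →₀ K))

/-- The standard basis of `A_n`. -/
noncomputable def basisA : Module.Basis (Label p n) K (A K p n) :=
  Module.Basis.ofRepr (LinearEquiv.refl K (Label p n →₀ K))

open Classical in
/-- The element `a_{σ s}^{(k)}` of `A_n`: a basis vector if `(k, σ, s)` is a label, and `0`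
otherwise. In particular it is `0` if `k > p` or `s > p`. -/
noncomputable def a (k : ℕ) (σ : Finset ℕ) (s : ℕ) : A K p n :=
  if h : IsLabel p n k σ s then basisA K p n ⟨(k, σ, s), h⟩ else 0

/-- The multiplication table of `A_n` on the basis:
`a_{σ s}^{(k)} a_{τ t}^{(l)} = (-1)^{|σ|} a_{σ ∪ τ, s + t}^{(k + l)}` if `k + l ≤ p`, `s + t ≤ p`,
`σ ∩ τ = ∅` and `|σ| + |τ|` is odd, and `0` in all other cases. -/
noncomputable def tableMul (i j : Label p n) : A K p n :=
  if i.1.1 + j.1.1 ≤ p ∧ i.1.2.2 + j.1.2.2 ≤ p ∧ Disjoint i.1.2.1 j.1.2.1 ∧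
      Odd (i.1.2.1.card + j.1.2.1.card) then
    (-1 : K) ^ i.1.2.1.card •
      a K p n (i.1.1 + j.1.1) (i.1.2.1 ∪ j.1.2.1) (i.1.2.2 + j.1.2.2)
  else 0

/-- The multiplication of `A_n`, the bilinear extension of the multiplication table. -/
noncomputable def mulA : A K p n →ₗ[K] A K p n →ₗ[K] A K p n :=
  (basisA K p n).constr K fun i =>
    (basisA K p n).constr K fun j => tableMul K p n i j

/-- The linear transformation `g_{λ t}` of `A_n`: it sends `a_{σ s}^{(k)}` to
`a_{σ ∪ λ, s + t}^{(k)}` if `s + t ≤ p`, `σ ∩ λ = ∅` and `|σ|` is even, and to `0` otherwise. -/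
noncomputable def gMap (lam : Finset ℕ) (t : ℕ) : A K p n →ₗ[K] A K p n :=
  (basisA K p n).constr K fun i =>
    if i.1.2.2 + t ≤ p ∧ Disjoint i.1.2.1 lam ∧ Even i.1.2.1.card then
      a K p n i.1.1 (i.1.2.1 ∪ lam) (i.1.2.2 + t)
    else 0

/-- The linear transformation `h_{μ t}` of `A_n`: it sends `a_{σ s}^{(k)}` to
`k a_{σ ∪ μ, s + t}^{(k)}` if `s + t ≤ p` and `σ ∩ μ = ∅`, and to `0` otherwise. -/
noncomputable def hMap (mu : Finset ℕ) (t : ℕ) : A K p n →ₗ[K] A K p n :=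
  (basisA K p n).constr K fun i =>
    if i.1.2.2 + t ≤ p ∧ Disjoint i.1.2.1 mu then
      (i.1.1 : K) • a K p n i.1.1 (i.1.2.1 ∪ mu) (i.1.2.2 + t)
    else 0

end

section

variable {K : Type u} [Field K] {p n : ℕ}

theorem a_of_label {k : ℕ} {σ : Finset ℕ} {s : ℕ} (h : IsLabel p n k σ s) :
    a K p n k σ s = basisA K p n ⟨(k, σ, s), h⟩ := dif_pos h

theorem a_of_not {k : ℕ} {σ : Finset ℕ} {s : ℕ} (h : ¬ IsLabel p n k σ s) :
    a K p n k σ s = 0 := dif_neg h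

theorem basisA_eq (i : Label p n) : basisA K p n i = a K p n i.1.1 i.1.2.1 i.1.2.2 :=
  (a_of_label i.2).symm

/-- The product of two elements `a_{σ s}^{(k)}`, `a_{τ t}^{(l)}`, also when they vanish. -/
theorem mulA_a {k l : ℕ} (σ τ : Finset ℕ) (s t : ℕ) (hk : 1 ≤ k) (hl : 1 ≤ l) :
    mulA K p n (a K p n k σ s) (a K p n l τ t) =
      if Disjoint σ τ ∧ Odd (σ.card + τ.card) ∧ (2 ≤ k → Odd σ.card) ∧ (2 ≤ l → Odd τ.card) then
        (-1 : K) ^ σ.card • a K p n (k + l) (σ ∪ τ) (s + t) else 0 := by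
  by_cases h₁ : IsLabel p n k σ s
  swap
  · rw [a_of_not h₁, map_zero, LinearMap.zero_apply]
    split_ifs with h
    · rw [a_of_not, smul_zero]
      intro h'
      refine h₁ ⟨hk, by have := h'.2.1; omega, by have := h'.2.2.1; omega,
        Finset.union_subset_left h'.2.2.2.1, h.2.2.1, fun e => ?_⟩
      have := h'.2.1
      omega
    · rfl
  by_cases h₂ : IsLabel p n l τ t
  swap
  · rw [a_of_not h₂, map_zero]
    split_ifs with h
    · rw [a_of_not, smul_zero]
      intro h'
      refine h₂ ⟨hl, by have := h'.2.1; omega, by have := h'.2.2.1; omega,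
        Finset.union_subset_right h'.2.2.2.1, h.2.2.2, fun e => ?_⟩
      have := h'.2.1
      omega
    · rfl
  have e₁ := h₁.2.2.2.2.1
  have e₂ := h₂.2.2.2.2.1
  rw [a_of_label h₁, a_of_label h₂, mulA, Module.Basis.constr_basis, Module.Basis.constr_basis,
    tableMul]
  dsimp only
  by_cases hk : k + l ≤ p ∧ s + t ≤ p
  · have e₃ : (2 ≤ k → Odd σ.card) ∧ (2 ≤ l → Odd τ.card) := ⟨e₁, e₂⟩
    simp only [hk, true_and]
    exact if_congr (by tauto) rfl rfl
  · have h0 : a K p n (k + l) (σ ∪ τ) (s + t) = 0 :=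
      a_of_not fun h => hk ⟨h.2.1, h.2.2.1⟩
    simp [h0]

theorem gMap_a (hp : 2 ≤ p) {k : ℕ} (σ lam : Finset ℕ) (s t : ℕ) :
    gMap K p n lam t (a K p n k σ s) =
      if k = 1 ∧ Disjoint σ lam ∧ Even σ.card then a K p n k (σ ∪ lam) (s + t) else 0 := by
  by_cases h₁ : IsLabel p n k σ s
  · rw [a_of_label h₁, gMap, Module.Basis.constr_basis]
    dsimp only
    have e₁ := h₁.2.2.2.2.1
    by_cases hs : s + t ≤ p
    · simp only [hs, true_and]
      by_cases hk : k = 1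
      · simp [hk]
      · have : Odd σ.card := e₁ (by have := h₁.1; omega)
        rw [if_neg (by grind), if_neg (by grind)]
    · have h0 : a K p n k (σ ∪ lam) (s + t) = 0 := a_of_not fun h => hs h.2.2.1
      simp [h0]
  · rw [a_of_not h₁, map_zero]
    split_ifs with h
    · rw [a_of_not]
      intro h'
      refine h₁ ⟨h'.1, h'.2.1, by have := h'.2.2.1; omega,
        Finset.union_subset_left h'.2.2.2.1, fun e => ?_, fun e => ?_⟩ <;> omega
    · rfl

theorem hMap_a [CharP K p] {k : ℕ} (σ : Finset ℕ) {mu : Finset ℕ} (hmu : Even mu.card)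
    (s t : ℕ) :
    hMap K p n mu t (a K p n k σ s) =
      if Disjoint σ mu then (k : K) • a K p n k (σ ∪ mu) (s + t) else 0 := by
  by_cases h₁ : IsLabel p n k σ s
  · rw [a_of_label h₁, hMap, Module.Basis.constr_basis]
    dsimp only
    by_cases hs : s + t ≤ p
    · simp only [hs, true_and]
    · have h0 : a K p n k (σ ∪ mu) (s + t) = 0 := a_of_not fun h => hs h.2.2.1
      simp [h0]
  · rw [a_of_not h₁, map_zero]
    split_ifs with h
    · by_cases hk : k = p
      · rw [hk, CharP.cast_eq_zero, zero_smul]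
      rw [a_of_not, smul_zero]
      intro h'
      refine h₁ ⟨h'.1, h'.2.1, by have := h'.2.2.1; omega,
        Finset.union_subset_left h'.2.2.2.1, fun e => ?_, fun e => absurd e hk⟩
      have := h'.2.2.2.2.1 e
      rw [Finset.card_union_of_disjoint h] at this
      exact (Nat.odd_add.1 this).2 hmu
    · rfl

theorem mulA_skew (x y : A K p n) : mulA K p n x y = -mulA K p n y x := by
  have : mulA K p n = -(mulA K p n).flip := by
    refine (basisA K p n).ext fun i => (basisA K p n).ext fun j => ?_
    simp only [LinearMap.neg_apply, LinearMap.flip_apply]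
    rw [basisA_eq, basisA_eq, mulA_a _ _ _ _ i.2.1 j.2.1, mulA_a _ _ _ _ j.2.1 i.2.1]
    rw [Finset.union_comm j.1.2.1, add_comm j.1.1, add_comm j.1.2.2]
    have hd := disjoint_comm (a := i.1.2.1) (b := j.1.2.1)
    split_ifs with h h' h'
    · rw [← neg_smul]
      congr 1
      rcases Nat.even_or_odd i.1.2.1.card with hi | hi <;>
      rcases Nat.even_or_odd j.1.2.1.card with hj | hj <;> grind [Even.neg_one_pow, Odd.neg_one_pow]
    · grind
    · grind
    · simp
  conv_lhs => rw [this]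
  rfl

theorem mulA_self (x : A K p n) : mulA K p n x x = 0 := by
  induction (basisA K p n).mem_span x using Submodule.span_induction with
  | mem x h =>
    obtain ⟨i, rfl⟩ := h
    rw [basisA_eq, mulA_a _ _ _ _ i.2.1 i.2.1, if_neg]
    grind
  | zero => simp
  | add x y _ _ hx hy =>
    simp [hx, hy, mulA_skew y x]
  | smul c x _ hx => simp [hx]

theorem mulA_leibniz (x y z : A K p n) :
    mulA K p n x (mulA K p n y z) =
      mulA K p n (mulA K p n x y) z + mulA K p n y (mulA K p n x z) := by
  have key : ∀ i j l : Label p n,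
      mulA K p n (basisA K p n i) (mulA K p n (basisA K p n j) (basisA K p n l)) =
        mulA K p n (mulA K p n (basisA K p n i) (basisA K p n j)) (basisA K p n l) +
          mulA K p n (basisA K p n j) (mulA K p n (basisA K p n i) (basisA K p n l)) := by
    intro i j l
    rw [basisA_eq, basisA_eq, basisA_eq]
    obtain ⟨⟨k₁, σ₁, s₁⟩, h₁, -⟩ := i
    obtain ⟨⟨k₂, σ₂, s₂⟩, h₂, -⟩ := j
    obtain ⟨⟨k₃, σ₃, s₃⟩, h₃, -⟩ := l
    dsimp only at h₁ h₂ h₃ ⊢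
    have h₁₂ : 1 ≤ k₁ + k₂ := by omega
    have h₁₃ : 1 ≤ k₁ + k₃ := by omega
    have h₂₃ : 1 ≤ k₂ + k₃ := by omega
    have g₁₂ : 2 ≤ k₁ + k₂ := by omega
    have g₁₃ : 2 ≤ k₁ + k₃ := by omega
    have g₂₃ : 2 ≤ k₂ + k₃ := by omega
    rw [mulA_a _ _ _ _ h₂ h₃, mulA_a _ _ _ _ h₁ h₂, mulA_a _ _ _ _ h₁ h₃]
    simp only [apply_ite (mulA K p n), apply_ite (mulA K p n _), map_smul, map_zero,
      DFunLike.ite_apply, LinearMap.smul_apply, LinearMap.zero_apply]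
    rw [mulA_a _ _ _ _ h₁ h₂₃, mulA_a _ _ _ _ h₁₂ h₃, mulA_a _ _ _ _ h₂ h₁₃]
    simp only [Finset.disjoint_union_left, Finset.disjoint_union_right, disjoint_comm (a := σ₂) (b := σ₁)]
    rw [Finset.union_left_comm σ₂ σ₁ σ₃, Finset.union_assoc, add_left_comm k₂ k₁ k₃, add_assoc k₁,
      add_left_comm s₂ s₁ s₃, add_assoc s₁]
    by_cases d₁₂ : Disjoint σ₁ σ₂
    swap
    · simp [d₁₂]
    by_cases d₁₃ : Disjoint σ₁ σ₃
    swap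
    · simp [d₁₃]
    by_cases d₂₃ : Disjoint σ₂ σ₃
    swap
    · simp [d₂₃]
    rw [Finset.card_union_of_disjoint d₁₂, Finset.card_union_of_disjoint d₁₃,
      Finset.card_union_of_disjoint d₂₃]
    generalize a K p n (k₁ + (k₂ + k₃)) (σ₁ ∪ (σ₂ ∪ σ₃)) (s₁ + (s₂ + s₃)) = w
    rcases Nat.even_or_odd σ₁.card with o₁ | o₁ <;>
    rcases Nat.even_or_odd σ₂.card with o₂ | o₂ <;>
    rcases Nat.even_or_odd σ₃.card with o₃ | o₃ <;>
    have p₁ := o₁.neg_one_pow (α := K) <;>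
    have p₂ := o₂.neg_one_pow (α := K) <;>
    simp only [← Nat.not_even_iff_odd] at o₁ o₂ o₃ ⊢ <;>
    simp [Nat.even_add, o₁, o₂, o₃, d₁₂, d₁₃, d₂₃, p₁, p₂, pow_add, g₁₂, g₁₃, g₂₃] <;>
    split_ifs <;> simp
  have lin : ∀ i j, mulA K p n (basisA K p n i) ∘ₗ mulA K p n (basisA K p n j) =
      mulA K p n (mulA K p n (basisA K p n i) (basisA K p n j)) +
        mulA K p n (basisA K p n j) ∘ₗ mulA K p n (basisA K p n i) :=
    fun i j => (basisA K p n).ext fun l => key i j l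
  have lin' := fun i j => LinearMap.congr_fun (lin i j) z
  simp only [LinearMap.comp_apply, LinearMap.add_apply] at lin'
  have step : ∀ i, mulA K p n (basisA K p n i) ∘ₗ (mulA K p n).flip z =
      (mulA K p n).flip z ∘ₗ mulA K p n (basisA K p n i) +
        (mulA K p n).flip (mulA K p n (basisA K p n i) z) :=
    fun i => (basisA K p n).ext fun j => lin' i j
  have step' := fun i => LinearMap.congr_fun (step i) y
  simp only [LinearMap.comp_apply, LinearMap.add_apply, LinearMap.flip_apply] at step'
  have last : (mulA K p n).flip (mulA K p n y z) =
      (mulA K p n).flip z ∘ₗ (mulA K p n).flip y + mulA K p n y ∘ₗ (mulA K p n).flip z :=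
    (basisA K p n).ext fun i => step' i
  exact LinearMap.congr_fun last x

noncomputable instance : LieRing (A K p n) where
  bracket x y := mulA K p n x y
  add_lie x y z := by change mulA K p n (x + y) z = _; rw [map_add]; rfl
  lie_add x y z := (mulA K p n x).map_add y z
  lie_self x := mulA_self x
  leibniz_lie x y z := mulA_leibniz x y z

noncomputable instance : LieAlgebra K (A K p n) where
  lie_smul c x y := (mulA K p n x).map_smul c y

theorem lie_def (x y : A K p n) : ⁅x, y⁆ = mulA K p n x y := rfl

/-- The Leibniz rule may be checked on the basis. -/
theorem leibniz_of_basis (f : A K p n →ₗ[K] A K p n)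
    (hf : ∀ i j : Label p n, f (mulA K p n (basisA K p n i) (basisA K p n j)) =
      mulA K p n (f (basisA K p n i)) (basisA K p n j) +
        mulA K p n (basisA K p n i) (f (basisA K p n j))) (x y : A K p n) :
    f (mulA K p n x y) = mulA K p n (f x) y + mulA K p n x (f y) := by
  have h₁ : ∀ i, f ∘ₗ mulA K p n (basisA K p n i) =
      mulA K p n (f (basisA K p n i)) + mulA K p n (basisA K p n i) ∘ₗ f :=
    fun i => (basisA K p n).ext fun j => hf i j
  have h₂ : f ∘ₗ (mulA K p n).flip y =
      (mulA K p n).flip y ∘ₗ f + (mulA K p n).flip (f y) :=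
    (basisA K p n).ext fun i => LinearMap.congr_fun (h₁ i) y
  exact LinearMap.congr_fun h₂ x

theorem gMap_leibniz (hp : 2 ≤ p) {lam : Finset ℕ} (hlam : Odd lam.card) (t : ℕ) (x y : A K p n) :
    gMap K p n lam t (mulA K p n x y) =
      mulA K p n (gMap K p n lam t x) y + mulA K p n x (gMap K p n lam t y) := by
  refine leibniz_of_basis _ (fun i j => ?_) x y
  rw [basisA_eq, basisA_eq]
  obtain ⟨⟨k₁, σ₁, s₁⟩, h₁, -⟩ := i
  obtain ⟨⟨k₂, σ₂, s₂⟩, h₂, -⟩ := j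
  dsimp only at h₁ h₂ ⊢
  rw [mulA_a _ _ _ _ h₁ h₂, gMap_a hp, gMap_a hp]
  simp only [apply_ite (mulA K p n), apply_ite (mulA K p n _), apply_ite (gMap K p n _ _),
    map_smul, map_zero, DFunLike.ite_apply, LinearMap.smul_apply, LinearMap.zero_apply]
  rw [mulA_a _ _ _ _ h₁ h₂, mulA_a _ _ _ _ h₁ h₂, gMap_a hp]
  have g : k₁ + k₂ ≠ 1 := by omega
  simp only [g, false_and, if_false, smul_zero, ite_self]
  have eu : σ₁ ∪ lam ∪ σ₂ = σ₁ ∪ (σ₂ ∪ lam) := by rw [Finset.union_assoc, Finset.union_comm lam]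
  rw [eu, add_right_comm s₁, add_assoc s₁]
  simp only [Finset.disjoint_union_left, Finset.disjoint_union_right,
    disjoint_comm (a := lam) (b := σ₂)]
  by_cases d₁₂ : Disjoint σ₁ σ₂
  swap
  · simp [d₁₂]
  by_cases d₁ : Disjoint σ₁ lam
  swap
  · simp [d₁]
  by_cases d₂ : Disjoint σ₂ lam
  swap
  · simp [d₂]
  rw [Finset.card_union_of_disjoint d₁, Finset.card_union_of_disjoint d₂]
  generalize a K p n (k₁ + k₂) (σ₁ ∪ (σ₂ ∪ lam)) (s₁ + (s₂ + t)) = w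
  rcases Nat.even_or_odd σ₁.card with o₁ | o₁ <;>
  rcases Nat.even_or_odd σ₂.card with o₂ | o₂ <;>
  have p₁ := o₁.neg_one_pow (α := K) <;>
  have p₀ := hlam.neg_one_pow (α := K) <;>
  simp only [← Nat.not_even_iff_odd] at o₁ o₂ hlam ⊢ <;>
  simp [Nat.even_add, o₁, o₂, hlam, d₁₂, d₁, d₂, p₁, p₀, pow_add] <;>
  grind

theorem hMap_leibniz [CharP K p] {mu : Finset ℕ} (hmu : Even mu.card) (t : ℕ) (x y : A K p n) :
    hMap K p n mu t (mulA K p n x y) =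
      mulA K p n (hMap K p n mu t x) y + mulA K p n x (hMap K p n mu t y) := by
  refine leibniz_of_basis _ (fun i j => ?_) x y
  rw [basisA_eq, basisA_eq]
  obtain ⟨⟨k₁, σ₁, s₁⟩, h₁, -⟩ := i
  obtain ⟨⟨k₂, σ₂, s₂⟩, h₂, -⟩ := j
  dsimp only at h₁ h₂ ⊢
  rw [mulA_a _ _ _ _ h₁ h₂, hMap_a _ hmu, hMap_a _ hmu]
  simp only [apply_ite (mulA K p n), apply_ite (mulA K p n _), apply_ite (hMap K p n _ _),
    map_smul, map_zero, DFunLike.ite_apply, LinearMap.smul_apply, LinearMap.zero_apply]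
  rw [mulA_a _ _ _ _ h₁ h₂, mulA_a _ _ _ _ h₁ h₂, hMap_a _ hmu]
  have eu : σ₁ ∪ mu ∪ σ₂ = σ₁ ∪ (σ₂ ∪ mu) := by rw [Finset.union_assoc, Finset.union_comm mu]
  have es : s₁ + t + s₂ = s₁ + (s₂ + t) := by omega
  rw [eu, es, Finset.union_assoc, add_assoc s₁ s₂ t]
  simp only [Finset.disjoint_union_left, Finset.disjoint_union_right,
    disjoint_comm (a := mu) (b := σ₂)]
  by_cases d₁₂ : Disjoint σ₁ σ₂
  swap
  · simp [d₁₂]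
  by_cases d₁ : Disjoint σ₁ mu
  swap
  · simp [d₁]
  by_cases d₂ : Disjoint σ₂ mu
  swap
  · simp [d₂]
  rw [Finset.card_union_of_disjoint d₁, Finset.card_union_of_disjoint d₂]
  generalize a K p n (k₁ + k₂) (σ₁ ∪ (σ₂ ∪ mu)) (s₁ + (s₂ + t)) = w
  rcases Nat.even_or_odd σ₁.card with o₁ | o₁ <;>
  rcases Nat.even_or_odd σ₂.card with o₂ | o₂ <;>
  have p₁ := o₁.neg_one_pow (α := K) <;>
  simp only [← Nat.not_even_iff_odd] at o₁ o₂ ⊢ <;>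
  simp [Nat.even_add, o₁, o₂, hmu, d₁₂, d₁, d₂, p₁, pow_add] <;>
  split_ifs <;> simp [add_smul, add_comm]

end

section

variable (K : Type u) [Field K] (p n : ℕ) [Fact p.Prime] [CharP K p]

/-- `g_{λ t}`, `|λ|` odd, as an element of the Lie algebra of derivations of `A_n`. Since the
transformation `x ↦ x g_{λ t}` is to be `x ↦ ⁅x, g_{λ t}⁆` in the split extension, the derivation
`x ↦ ⁅g_{λ t}, x⁆` is its negative. -/
noncomputable def gDer (lam : Finset ℕ) (hlam : Odd lam.card) (t : ℕ) :
    LieDerivation K (A K p n) (A K p n) where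
  toLinearMap := -gMap K p n lam t
  leibniz' x y := by
    have hp : 2 ≤ p := (Fact.out : p.Prime).two_le
    simp only [lie_def, LinearMap.neg_apply, map_neg]
    rw [gMap_leibniz hp hlam, mulA_skew y]
    abel

/-- `h_{μ t}`, `|μ|` even, as an element of the Lie algebra of derivations of `A_n`, with the same
convention. -/
noncomputable def hDer (mu : Finset ℕ) (hmu : Even mu.card) (t : ℕ) :
    LieDerivation K (A K p n) (A K p n) where
  toLinearMap := -hMap K p n mu t
  leibniz' x y := by
    simp only [lie_def, LinearMap.neg_apply, map_neg]
    rw [hMap_leibniz hmu, mulA_skew y]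
    abel

/-- The (abelian) Lie algebra `D_n` of derivations of `A_n` generated by all `g_{λ t}` and
`h_{μ t}` with `λ, μ ⊆ {1, …, 2n-1}`, `|λ|` odd, `|μ|` even, `0 ≤ t ≤ p`. -/
noncomputable def D : LieSubalgebra K (LieDerivation K (A K p n) (A K p n)) :=
  LieSubalgebra.lieSpan K _
    ({d | ∃ (lam : Finset ℕ) (hlam : Odd lam.card) (t : ℕ),
        lam ⊆ Finset.Icc 1 (2 * n - 1) ∧ t ≤ p ∧ d = gDer K p n lam hlam t} ∪
      {d | ∃ (mu : Finset ℕ) (hmu : Even mu.card) (t : ℕ),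
        mu ⊆ Finset.Icc 1 (2 * n - 1) ∧ t ≤ p ∧ d = hDer K p n mu hmu t})

/-- The split extension `B_n` of `A_n` by `D_n`. -/
abbrev B : Type u := LieAlgebra.SemiDirectSum (A K p n) (D K p n) (D K p n).incl

/-- The element `g_{λ t}` of `B_n`. -/
noncomputable def gB (lam : Finset ℕ) (hlam : Odd lam.card)
    (hs : lam ⊆ Finset.Icc 1 (2 * n - 1)) (t : ℕ) (ht : t ≤ p) : B K p n :=
  LieAlgebra.SemiDirectSum.inr _ ⟨gDer K p n lam hlam t,
    LieSubalgebra.subset_lieSpan (Or.inl ⟨lam, hlam, t, hs, ht, rfl⟩)⟩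

/-- The element `h_{μ t}` of `B_n`. -/
noncomputable def hB (mu : Finset ℕ) (hmu : Even mu.card)
    (hs : mu ⊆ Finset.Icc 1 (2 * n - 1)) (t : ℕ) (ht : t ≤ p) : B K p n :=
  LieAlgebra.SemiDirectSum.inr _ ⟨hDer K p n mu hmu t,
    LieSubalgebra.subset_lieSpan (Or.inr ⟨mu, hmu, t, hs, ht, rfl⟩)⟩

/-- The element `a_{σ s}^{(k)}` of `B_n`. -/
noncomputable def aB (k : ℕ) (σ : Finset ℕ) (s : ℕ) : B K p n :=
  LieAlgebra.SemiDirectSum.inl _ (a K p n k σ s)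

/-- For `n ≥ 1`, the subalgebra `C_n` of `B_n` generated by `a_{∅ 0}^{(1)}`, `g_{{1} 0}`, `h_{∅ 1}`
and `h_{μ 0}` for `μ = {2, 3}, {4, 5}, …, {2n-2, 2n-1}`. -/
noncomputable def C (n : ℕ+) : LieSubalgebra K (B K p n) :=
  LieSubalgebra.lieSpan K (B K p n)
    ({aB K p n 1 ∅ 0,
      gB K p n {1} (by decide) (by have := n.pos; simp; omega) 0 (Nat.zero_le p),
      hB K p n ∅ (by decide) (by simp) 1 (Fact.out : p.Prime).one_le} ∪
      {x | ∃ (j : ℕ) (h₁ : 1 ≤ j) (h₂ : j < n),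
        x = hB K p n {2 * j, 2 * j + 1} (by rw [Finset.card_pair (by omega)]; decide)
          (by intro i hi; simp at hi ⊢; omega) 0 (Nat.zero_le p)})

/-- The algebra `L_r = C_m`, where `m` is the number of the rational number `r` in the enumeration
`r₁, r₂, …` of the rational numbers. -/
abbrev L (enum : ℕ+ ≃ ℚ) (r : ℚ) : Type u := C K p (enum.symm r)

/-- The variety `W_α = var {L_r | r ∈ ℚ, r ≤ α}`. -/
noncomputable def W (enum : ℕ+ ≃ ℚ) (α : ℝ) : LieVariety K :=
  LieVariety.generatedBy K fun r : {r : ℚ // (r : ℝ) ≤ α} => L K p enum r.1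

end

end Drensky

/-!
Elements of `C_n` are sums of an operator in the span of the commuting operators `g = g_{{1} 0}`,
`h_0 = h_{∅ 1}`, `h_j = h_{{2j, 2j+1} 0}` and an element of `A_n`. The grading of `A_n` by the upper
index `k` is nilpotent, since `k ≤ p`, and the components with `k = 1` of elements of `C_n` are
elements `a (F + G g)`, where `a = a_{∅ 0}^{(1)}` and `F`, `G` are polynomials in the `h`'s. The maps
`Drensky.emb` give these coordinates: up to sign, the product of `a F` and the element of index `k`
with coordinate `G g` is the element of index `k + 1` with coordinate `F G g`, and all other products
vanish.

*Local finiteness.* By the Frobenius identity `e ^ p` is a multiple of `h_0 ^ p` for each operator `e`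
in the span, so `e ^ (2 * p) = 0` (`Drensky.pow_eq_zero_of_mem_ops`). Hence a product of more than
`2pd` of `d` such operators vanishes, and a commutator of this length in `d` elements raises the
index `k`. So commutators in `d` elements vanish from a length on that does not depend on `n`
(`Drensky.foldr_lie_eq_zero`). The right-normed commutators in `d` variables of that length are
therefore identities of the varieties, and an algebra generated by `d` elements is spanned by
finitely many of its commutators.

*Strict inclusions.* The identity that separates `C_m` from all other `C_k` is
`[w, z_0, …, z_{m-1}, w, …, w] = 0` with `w = [x, y]` and `p - 1` copies of `w` at the end
(`Drensky.separator`). Let `w` have coordinates `R + S g`, where `R` has no constant term, and let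
`P + Q g` be the product of the operators `z_i`, so that `Q` is homogeneous of degree `m - 1`.
Then `[w, z_0, …, z_{m-1}]` has coordinates `P R + (P S + Q R) g`, and in its product with `w` the
terms with `P` cancel, which leaves `- Q R ^ 2`. The remaining `p - 2` factors turn this into
`± Q R ^ p` in the layer `k = p` (`Drensky.separator_eq`). There `a_{σ s}^{(p)}` is nonzero for the
full set `σ` only, that is, only the monomials `h_0 ^ s h_1 ⋯ h_{k-1}` of `C_k` with `s ≤ p` survive.
But `R ^ p` is a sum of multiples of `p`-th powers of nonconstant monomials, of which only `h_0 ^ p`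
survives, so `Q` has to contribute `h_1 ⋯ h_{k-1}`, and `m = k`
(`Drensky.emb_top_mul_pow_eq_zero`). For `k = m` this value does occur
(`Drensky.exists_separator_ne_zero`).
-/

namespace Drensky

/-! ### The filtration of `A_n` by the upper index -/

section Filtration

variable (K : Type u) [Field K] (p n : ℕ)

/-- The subspace of `A_n` spanned by all `a_{σ s}^{(k)}` with `k ≥ i`. -/
noncomputable def fil (i : ℕ) : Submodule K (A K p n) :=
  Submodule.span K {x | ∃ k σ s, i ≤ k ∧ x = a K p n k σ s}

variable {K p n}

theorem a_mem_fil {i k : ℕ} (h : i ≤ k) (σ : Finset ℕ) (s : ℕ) : a K p n k σ s ∈ fil K p n i :=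
  Submodule.subset_span ⟨k, σ, s, h, rfl⟩

theorem mem_fil_one (x : A K p n) : x ∈ fil K p n 1 := by
  induction (basisA K p n).mem_span x using Submodule.span_induction with
  | mem x h =>
    obtain ⟨i, rfl⟩ := h
    rw [basisA_eq]
    exact a_mem_fil i.2.1 _ _
  | zero => exact zero_mem _
  | add x y _ _ hx hy => exact add_mem hx hy
  | smul c x _ hx => exact Submodule.smul_mem _ c hx

theorem eq_zero_of_mem_fil {i : ℕ} (hi : p < i) {x : A K p n} (hx : x ∈ fil K p n i) : x = 0 := by
  induction hx using Submodule.span_induction with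
  | mem x h =>
    obtain ⟨k, σ, s, h, rfl⟩ := h
    exact a_of_not fun h' => by have := h'.2.1; omega
  | zero => rfl
  | add x y _ _ hx hy => rw [hx, hy, add_zero]
  | smul c x _ hx => rw [hx, smul_zero]

theorem mulA_mem_fil {i j : ℕ} (hi : 1 ≤ i) (hj : 1 ≤ j) {x y : A K p n} (hx : x ∈ fil K p n i)
    (hy : y ∈ fil K p n j) : mulA K p n x y ∈ fil K p n (i + j) := by
  induction hx, hy using Submodule.span_induction₂ with
  | mem_mem x y hx hy =>
    obtain ⟨k, σ, s, hk, rfl⟩ := hx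
    obtain ⟨l, τ, t, hl, rfl⟩ := hy
    rw [mulA_a _ _ _ _ (hi.trans hk) (hj.trans hl)]
    split_ifs
    · exact Submodule.smul_mem _ _ (a_mem_fil (by omega) _ _)
    · exact zero_mem _
  | zero_left y _ => simp
  | zero_right x _ => simp
  | add_left x y z _ _ _ hx hy => rw [map_add]; exact add_mem hx hy
  | add_right x y z _ _ _ hx hy => rw [map_add]; exact add_mem hx hy
  | smul_left r x y _ _ h => rw [map_smul]; exact Submodule.smul_mem _ _ h
  | smul_right r x y _ _ h => rw [map_smul]; exact Submodule.smul_mem _ _ h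

end Filtration

/-! ### Polynomial coordinates -/

section Coordinates

/-- The union of the pairs `{2j, 2j+1}` over all `j ≥ 1` in the support of `ν`. -/
def pairs (ν : ℕ →₀ ℕ) : Finset ℕ := (ν.support.erase 0).biUnion fun j => {2 * j, 2 * j + 1}

theorem mem_pairs {ν : ℕ →₀ ℕ} {i : ℕ} : i ∈ pairs ν ↔ 2 ≤ i ∧ ν (i / 2) ≠ 0 := by
  simp only [pairs, Finset.mem_biUnion, Finset.mem_erase, Finsupp.mem_support_iff,
    Finset.mem_insert, Finset.mem_singleton]
  constructor
  · rintro ⟨j, ⟨h₀, h⟩, rfl | rfl⟩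
    · refine ⟨by omega, ?_⟩
      rwa [show 2 * j / 2 = j by omega]
    · refine ⟨by omega, ?_⟩
      rwa [show (2 * j + 1) / 2 = j by omega]
  · rintro ⟨h₂, h⟩
    exact ⟨i / 2, ⟨by omega, h⟩, by omega⟩

theorem even_card_pairs (ν : ℕ →₀ ℕ) : Even (pairs ν).card := by
  rw [pairs, Finset.card_biUnion]
  · refine Finset.even_sum _ fun j _ => ?_
    rw [Finset.card_pair (by omega)]
    exact even_two
  · intro i _ j _ hij
    rw [Function.onFun, Finset.disjoint_left]
    intro x hx hy
    simp only [Finset.mem_insert, Finset.mem_singleton] at hx hy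
    omega

theorem pairs_zero : pairs 0 = ∅ := by simp [pairs]

theorem one_notMem_pairs (ν : ℕ →₀ ℕ) : 1 ∉ pairs ν := by
  rw [mem_pairs]
  omega

theorem pairs_add (μ ν : ℕ →₀ ℕ) : pairs (μ + ν) = pairs μ ∪ pairs ν := by
  ext i
  simp only [Finset.mem_union, mem_pairs, Finsupp.add_apply]
  omega

/-- The multi-indices `ν` for which `∏ h_j ^ ν_j` contains no square of a derivation
`h_{{2j, 2j+1} 0}`, `j ≥ 1`. -/
def IsReduced (ν : ℕ →₀ ℕ) : Prop := ∀ j, 1 ≤ j → ν j ≤ 1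

noncomputable instance : DecidablePred IsReduced := Classical.decPred _

theorem isReduced_add {μ ν : ℕ →₀ ℕ} :
    IsReduced (μ + ν) ↔ IsReduced μ ∧ IsReduced ν ∧ Disjoint (pairs μ) (pairs ν) := by
  simp only [IsReduced, Finset.disjoint_left, mem_pairs, Finsupp.add_apply]
  constructor
  · refine fun h => ⟨fun j hj => ?_, fun j hj => ?_, fun i hi hi' => ?_⟩
    · have := h j hj; omega
    · have := h j hj; omega
    · have := h (i / 2) (by omega); omega
  · rintro ⟨h₁, h₂, h₃⟩ j hj
    have := h₁ j hj
    have := h₂ j hj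
    have := @h₃ (2 * j)
    rw [show 2 * j / 2 = j by omega] at this
    omega

variable (K : Type u) [Field K] (p n : ℕ)

/-- The linear map `F ↦ a_{τ 0}^{(k)} F` for polynomials `F` in commuting variables that stand for
the operators `h_{∅ 1}`, `h_{{2, 3} 0}`, `h_{{4, 5} 0}`, …, but with the factors `k` of these
operators removed: the monomial `X^ν` goes to `a_{τ ∪ σ, ν 0}^{(k)}`, where `σ` is the union of the
pairs that occur in `ν`, or to `0` if `ν` contains a pair twice. -/
noncomputable def emb (k : ℕ) (τ : Finset ℕ) : MvPolynomial ℕ K →ₗ[K] A K p n :=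
  (MvPolynomial.basisMonomials ℕ K).constr K fun ν =>
    if IsReduced ν then a K p n k (τ ∪ pairs ν) (ν 0) else 0

variable {K p n}

theorem emb_monomial (k : ℕ) (τ : Finset ℕ) (ν : ℕ →₀ ℕ) :
    emb K p n k τ (MvPolynomial.monomial ν 1) =
      if IsReduced ν then a K p n k (τ ∪ pairs ν) (ν 0) else 0 := by
  have h : (MvPolynomial.monomial ν 1 : MvPolynomial ℕ K) = MvPolynomial.basisMonomials ℕ K ν := by
    rw [MvPolynomial.coe_basisMonomials]
  rw [emb, h, Module.Basis.constr_basis]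

theorem emb_mem_fil {i k : ℕ} (h : i ≤ k) (τ : Finset ℕ) (F : MvPolynomial ℕ K) :
    emb K p n k τ F ∈ fil K p n i := by
  induction (MvPolynomial.basisMonomials ℕ K).mem_span F using Submodule.span_induction with
  | mem F hF =>
    obtain ⟨ν, rfl⟩ := hF
    rw [MvPolynomial.coe_basisMonomials, emb_monomial]
    split_ifs
    · exact a_mem_fil h _ _
    · exact zero_mem _
  | zero => simp
  | add x y _ _ hx hy => rw [map_add]; exact add_mem hx hy
  | smul c x _ hx => rw [map_smul]; exact Submodule.smul_mem _ _ hx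

/-- Two linear maps on polynomials agree if they do on the monomials. -/
theorem lhom_ext_monomial {M : Type*} [AddCommGroup M] [Module K M]
    {f g : MvPolynomial ℕ K →ₗ[K] M}
    (h : ∀ ν, f (MvPolynomial.monomial ν 1) = g (MvPolynomial.monomial ν 1)) : f = g :=
  (MvPolynomial.basisMonomials ℕ K).ext fun ν => by
    rw [MvPolynomial.coe_basisMonomials]
    exact h ν

theorem mulA_emb_emb {k : ℕ} (hk : 1 ≤ k) (F G : MvPolynomial ℕ K) :
    mulA K p n (emb K p n 1 ∅ F) (emb K p n k {1} G) = emb K p n (k + 1) {1} (F * G) := by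
  have key : (mulA K p n).compl₁₂ (emb K p n 1 ∅) (emb K p n k {1}) =
      (LinearMap.mul K (MvPolynomial ℕ K)).compr₂ (emb K p n (k + 1) {1}) := by
    refine lhom_ext_monomial fun μ => lhom_ext_monomial fun ν => ?_
    simp only [LinearMap.compl₁₂_apply, LinearMap.compr₂_apply, LinearMap.mul_apply',
      MvPolynomial.monomial_mul, one_mul]
    simp only [emb_monomial, isReduced_add]
    by_cases hμ : IsReduced μ
    swap
    · simp [hμ]
    by_cases hν : IsReduced ν
    swap
    · simp [hν]
    have e₁ := even_card_pairs μ
    have e₂ := even_card_pairs ν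
    have c : ({1} ∪ pairs ν : Finset ℕ).card = 1 + (pairs ν).card :=
      Finset.card_union_of_disjoint (by simpa using one_notMem_pairs ν)
    simp only [hμ, hν, true_and, if_true, Finset.empty_union]
    rw [mulA_a _ _ _ _ le_rfl hk, e₁.neg_one_pow, one_smul, c, add_comm 1 k, pairs_add,
      Finset.union_left_comm]
    refine if_congr ?_ rfl rfl
    rw [Finset.disjoint_union_right, Finset.disjoint_singleton_right]
    have := one_notMem_pairs μ
    grind
  exact LinearMap.congr_fun (LinearMap.congr_fun key F) G

theorem mulA_emb_empty (F G : MvPolynomial ℕ K) :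
    mulA K p n (emb K p n 1 ∅ F) (emb K p n 1 ∅ G) = 0 := by
  have key : (mulA K p n).compl₁₂ (emb K p n 1 ∅) (emb K p n 1 ∅) = 0 := by
    refine lhom_ext_monomial fun μ => lhom_ext_monomial fun ν => ?_
    simp only [LinearMap.compl₁₂_apply, emb_monomial, LinearMap.zero_apply]
    split_ifs <;> try simp
    have e₁ := even_card_pairs μ
    have e₂ := even_card_pairs ν
    rw [mulA_a _ _ _ _ le_rfl le_rfl, if_neg]
    grind
  exact LinearMap.congr_fun (LinearMap.congr_fun key F) G

theorem mulA_emb_singleton {k l : ℕ} (hk : 1 ≤ k) (hl : 1 ≤ l) (F G : MvPolynomial ℕ K) :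
    mulA K p n (emb K p n k {1} F) (emb K p n l {1} G) = 0 := by
  have key : (mulA K p n).compl₁₂ (emb K p n k {1}) (emb K p n l {1}) = 0 := by
    refine lhom_ext_monomial fun μ => lhom_ext_monomial fun ν => ?_
    simp only [LinearMap.compl₁₂_apply, emb_monomial, LinearMap.zero_apply]
    split_ifs <;> try simp
    rw [mulA_a _ _ _ _ hk hl, if_neg]
    simp
  exact LinearMap.congr_fun (LinearMap.congr_fun key F) G

theorem gMap_emb_empty (hp : 2 ≤ p) (F : MvPolynomial ℕ K) :
    gMap K p n {1} 0 (emb K p n 1 ∅ F) = emb K p n 1 {1} F := by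
  have key : gMap K p n {1} 0 ∘ₗ emb K p n 1 ∅ = emb K p n 1 {1} := by
    refine lhom_ext_monomial fun ν => ?_
    simp only [LinearMap.comp_apply, emb_monomial]
    split_ifs
    · rw [gMap_a hp, if_pos, Finset.empty_union, Finset.union_comm, add_zero]
      simpa using ⟨one_notMem_pairs ν, even_card_pairs ν⟩
    · exact map_zero _
  exact LinearMap.congr_fun key F

theorem gMap_emb_singleton (hp : 2 ≤ p) (F : MvPolynomial ℕ K) :
    gMap K p n {1} 0 (emb K p n 1 {1} F) = 0 := by
  have key : gMap K p n {1} 0 ∘ₗ emb K p n 1 {1} = 0 := by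
    refine lhom_ext_monomial fun ν => ?_
    simp only [LinearMap.comp_apply, emb_monomial, LinearMap.zero_apply]
    split_ifs
    · rw [gMap_a hp, if_neg]
      simp
    · exact map_zero _
  exact LinearMap.congr_fun key F

theorem hMap_zero_emb [CharP K p] {τ : Finset ℕ} (F : MvPolynomial ℕ K) :
    hMap K p n ∅ 1 (emb K p n 1 τ F) = emb K p n 1 τ (MvPolynomial.X 0 * F) := by
  have key : hMap K p n ∅ 1 ∘ₗ emb K p n 1 τ =
      emb K p n 1 τ ∘ₗ LinearMap.mulLeft K (MvPolynomial.X 0) := by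
    refine lhom_ext_monomial fun ν => ?_
    simp only [LinearMap.comp_apply, LinearMap.mulLeft_apply, MvPolynomial.X,
      MvPolynomial.monomial_mul, one_mul, emb_monomial, isReduced_add]
    have h₁ : IsReduced (Finsupp.single 0 1) := fun j hj => by
      rw [Finsupp.single_apply]
      split_ifs <;> simp
    have h₂ : pairs (Finsupp.single 0 1) = ∅ := by
      ext i
      rw [mem_pairs, Finsupp.single_apply]
      simp
      omega
    simp only [h₁, h₂, pairs_add, true_and, Finset.disjoint_empty_left, and_true,
      Finset.empty_union]
    split_ifs
    · rw [hMap_a _ (by simp)]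
      simp [add_comm]
    · exact map_zero _
  exact LinearMap.congr_fun key F

theorem hMap_pair_emb [CharP K p] {τ : Finset ℕ} (hτ : τ ⊆ {1}) {j : ℕ} (hj : 1 ≤ j)
    (F : MvPolynomial ℕ K) :
    hMap K p n {2 * j, 2 * j + 1} 0 (emb K p n 1 τ F) =
      emb K p n 1 τ (MvPolynomial.X j * F) := by
  have key : hMap K p n {2 * j, 2 * j + 1} 0 ∘ₗ emb K p n 1 τ =
      emb K p n 1 τ ∘ₗ LinearMap.mulLeft K (MvPolynomial.X j) := by
    refine lhom_ext_monomial fun ν => ?_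
    simp only [LinearMap.comp_apply, LinearMap.mulLeft_apply, MvPolynomial.X,
      MvPolynomial.monomial_mul, one_mul, emb_monomial, isReduced_add]
    have h₁ : IsReduced (Finsupp.single j 1) := fun i hi => by
      rw [Finsupp.single_apply]
      split_ifs <;> simp
    have h₂ : pairs (Finsupp.single j 1) = {2 * j, 2 * j + 1} := by
      ext i
      rw [mem_pairs, Finsupp.single_apply]
      simp
      omega
    have h₃ : Disjoint τ {2 * j, 2 * j + 1} := by
      refine Finset.disjoint_of_subset_left hτ ?_
      simp
      omega
    have h₄ : Finsupp.single j 1 0 = 0 := by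
      rw [Finsupp.single_apply, if_neg (by omega)]
    simp only [h₁, h₂, pairs_add, true_and, Finsupp.add_apply, h₄, zero_add]
    by_cases hν : IsReduced ν
    · simp only [hν, true_and, if_true]
      rw [hMap_a _ (by rw [Finset.card_pair (by omega)]; exact even_two)]
      simp only [Nat.cast_one, one_smul, add_zero, Finset.disjoint_union_left, h₃, true_and]
      rw [Finset.union_assoc, Finset.union_comm (pairs ν)]
      exact if_congr disjoint_comm rfl rfl
    · simp [hν]
  exact LinearMap.congr_fun key F

/-- The top layer `k = p` sees only the monomials `h_0^s h_1 ⋯ h_{n-1}` with `s ≤ p`: there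
`a_{σ s}^{(p)}` is nonzero for the full set `σ` only. -/
theorem emb_top_monomial (hn : 1 ≤ n) {ν : ℕ →₀ ℕ}
    (h : emb K p n p {1} (MvPolynomial.monomial ν 1) ≠ 0) :
    ν 0 ≤ p ∧ (∀ j, 1 ≤ j → j < n → ν j = 1) ∧ ∀ j, n ≤ j → ν j = 0 := by
  rw [emb_monomial] at h
  split_ifs at h with hr
  · have hl : IsLabel p n p ({1} ∪ pairs ν) (ν 0) := by
      by_contra h'
      exact h (a_of_not h')
    have hs := hl.2.2.2.2.2 rfl
    refine ⟨hl.2.2.1, fun j hj hjn => ?_, fun j hj => ?_⟩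
    · have : 2 * j ∈ ({1} ∪ pairs ν : Finset ℕ) := by
        rw [hs, Finset.mem_Icc]
        omega
      rw [Finset.mem_union, Finset.mem_singleton, mem_pairs, show 2 * j / 2 = j by omega] at this
      have := hr j hj
      omega
    · by_contra h0
      have : 2 * j ∈ ({1} ∪ pairs ν : Finset ℕ) := by
        rw [Finset.mem_union, mem_pairs, show 2 * j / 2 = j by omega]
        exact Or.inr ⟨by omega, h0⟩
      rw [hs, Finset.mem_Icc] at this
      omega
  · exact absurd rfl h

/-- The monomial `h_0^p h_1 ⋯ h_{n-1}` survives in the top layer. -/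
theorem emb_top_ne_zero (hn : 1 ≤ n) (hp : 1 ≤ p) {ν : ℕ →₀ ℕ} (h₀ : ν 0 = p)
    (h₁ : ∀ j, 1 ≤ j → j < n → ν j = 1) (h₂ : ∀ j, n ≤ j → ν j = 0) :
    emb K p n p {1} (MvPolynomial.monomial ν 1) ≠ 0 := by
  have hs : ({1} ∪ pairs ν : Finset ℕ) = Finset.Icc 1 (2 * n - 1) := by
    ext i
    rw [Finset.mem_union, Finset.mem_singleton, mem_pairs, Finset.mem_Icc]
    have := h₁ (i / 2)
    have := h₂ (i / 2)
    omega
  have hl : IsLabel p n p ({1} ∪ pairs ν) (ν 0) := by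
    refine ⟨hp, le_rfl, h₀.le, hs.subset, fun _ => ?_, fun _ => hs⟩
    rw [hs, Nat.card_Icc]
    exact ⟨n - 1, by omega⟩
  rw [emb_monomial, if_pos, a_of_label hl]
  · exact (basisA K p n).ne_zero _
  · intro j hj
    have := h₁ j hj
    have := h₂ j
    omega

end Coordinates

/-! ### The commuting operators that act on `A_n` -/

section Operators

theorem hMap_commute {K : Type u} [Field K] {p n : ℕ} [CharP K p] {mu mu' : Finset ℕ}
    (hmu : Even mu.card) (hmu' : Even mu'.card) (t t' : ℕ) :
    Commute (hMap K p n mu t : Module.End K (A K p n)) (hMap K p n mu' t') := by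
  refine (basisA K p n).ext fun i => ?_
  rw [basisA_eq, Module.End.mul_apply, Module.End.mul_apply, hMap_a _ hmu', hMap_a _ hmu]
  simp only [apply_ite (hMap K p n _ _), map_smul, map_zero, hMap_a _ hmu, hMap_a _ hmu']
  simp only [Finset.disjoint_union_left, disjoint_comm (a := mu') (b := mu)]
  rw [Finset.union_right_comm, add_right_comm]
  split_ifs <;> first | rfl | (exfalso; tauto) | simp

theorem gMap_commute_hMap {K : Type u} [Field K] {p n : ℕ} [CharP K p] (hp : 2 ≤ p)
    (lam : Finset ℕ) {mu : Finset ℕ} (hmu : Even mu.card) (t t' : ℕ) :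
    Commute (gMap K p n lam t : Module.End K (A K p n)) (hMap K p n mu t') := by
  refine (basisA K p n).ext fun i => ?_
  rw [basisA_eq, Module.End.mul_apply, Module.End.mul_apply, hMap_a _ hmu, gMap_a hp]
  simp only [apply_ite (hMap K p n _ _), apply_ite (gMap K p n _ _), map_smul, map_zero,
    hMap_a _ hmu, gMap_a hp]
  rw [Finset.union_right_comm, add_right_comm]
  by_cases hd : Disjoint i.1.2.1 mu
  swap
  · simp [hd]
  rw [Finset.card_union_of_disjoint hd]
  simp only [Finset.disjoint_union_left, disjoint_comm (a := lam) (b := mu)]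
  have := @Nat.even_add i.1.2.1.card mu.card
  split_ifs <;> first | rfl | (exfalso; grind) | simp

variable (K : Type u) [Field K] (p n : ℕ)

/-- The operators `g_{{1} 0}`, `h_{∅ 1}` and `h_{{2j, 2j+1} 0}`, `j ≥ 1`, on `A_n`. -/
def generatingOps : Set (Module.End K (A K p n)) :=
  {gMap K p n {1} 0, hMap K p n ∅ 1} ∪ {f | ∃ j, 1 ≤ j ∧ f = hMap K p n {2 * j, 2 * j + 1} 0}

/-- The linear span of the operators `g_{{1} 0}`, `h_{∅ 1}` and `h_{{2j, 2j+1} 0}`. -/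
noncomputable def ops : Submodule K (Module.End K (A K p n)) :=
  Submodule.span K (generatingOps K p n)

variable {K p n}

theorem even_card_pair (j : ℕ) : Even ({2 * j, 2 * j + 1} : Finset ℕ).card := by
  rw [Finset.card_pair (by omega)]
  exact even_two

theorem ops_commute [CharP K p] (hp : 2 ≤ p) {d e : Module.End K (A K p n)}
    (hd : d ∈ ops K p n) (he : e ∈ ops K p n) : Commute d e := by
  induction hd, he using Submodule.span_induction₂ with
  | mem_mem x y hx hy =>
    rcases hx with (rfl | rfl) | ⟨j, -, rfl⟩ <;> rcases hy with (rfl | rfl) | ⟨i, -, rfl⟩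
    · exact Commute.refl _
    · exact gMap_commute_hMap hp _ Even.zero _ _
    · exact gMap_commute_hMap hp _ (even_card_pair _) _ _
    · exact (gMap_commute_hMap hp _ Even.zero _ _).symm
    · exact Commute.refl _
    · exact hMap_commute Even.zero (even_card_pair _) _ _
    · exact (gMap_commute_hMap hp _ (even_card_pair _) _ _).symm
    · exact hMap_commute (even_card_pair _) Even.zero _ _
    · exact hMap_commute (even_card_pair _) (even_card_pair _) _ _
  | zero_left y _ => exact Commute.zero_left _
  | zero_right x _ => exact Commute.zero_right _
  | add_left x y z _ _ _ hx hy => exact hx.add_left hy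
  | add_right x y z _ _ _ hx hy => exact hx.add_right hy
  | smul_left r x y _ _ h => exact h.smul_left r
  | smul_right r x y _ _ h => exact h.smul_right r

theorem hMap_empty_pow [CharP K p] (i k : ℕ) (σ : Finset ℕ) (s : ℕ) :
    ((hMap K p n ∅ 1 : Module.End K (A K p n)) ^ i) (a K p n k σ s) =
      (k : K) ^ i • a K p n k σ (s + i) := by
  induction i with
  | zero => simp
  | succ i ih =>
    rw [pow_succ', Module.End.mul_apply, ih, map_smul, hMap_a _ Even.zero,
      if_pos (Finset.disjoint_empty_right _), smul_smul, Finset.union_empty, pow_succ, add_assoc]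

theorem hMap_empty_pow_eq_zero [CharP K p] {i : ℕ} (hi : p < i) :
    (hMap K p n ∅ 1 : Module.End K (A K p n)) ^ i = 0 := by
  refine (basisA K p n).ext fun j => ?_
  rw [basisA_eq, hMap_empty_pow, a_of_not, smul_zero, LinearMap.zero_apply]
  intro h
  have := h.2.2.1
  omega

instance [Fact p.Prime] : Nontrivial (A K p n) := by
  have hp := (Fact.out : p.Prime).two_le
  have hl : IsLabel p n 1 ∅ 0 :=
    ⟨le_rfl, by omega, Nat.zero_le _, Finset.empty_subset _, by omega, by omega⟩
  exact ⟨basisA K p n ⟨(1, ∅, 0), hl⟩, 0, (basisA K p n).ne_zero _⟩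

/-- By the Frobenius identity, the `p`-th power of an operator in the span only depends on the
coefficient of `h_{∅ 1}`, since the other generators have square zero. -/
theorem pow_mem_span_of_mem_ops [Fact p.Prime] [CharP K p] {e : Module.End K (A K p n)}
    (he : e ∈ ops K p n) :
    e ^ p ∈ Submodule.span K {(hMap K p n ∅ 1 : Module.End K (A K p n)) ^ p} := by
  have hp := (Fact.out : p.Prime).two_le
  have : CharP (Module.End K (A K p n)) p :=
    charP_of_injective_algebraMap (algebraMap K (Module.End K (A K p n))).injective p
  have sq : ∀ f : Module.End K (A K p n), f * f = 0 → f ^ p = 0 := fun f hf => by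
    exact pow_eq_zero_of_le hp (by rw [pow_two, hf])
  induction he using Submodule.span_induction with
  | mem f hf =>
    rcases hf with (rfl | rfl) | ⟨j, hj, rfl⟩
    · have h₀ := sq (gMap K p n {1} 0) ((basisA K p n).ext fun i => by
        rw [basisA_eq, Module.End.mul_apply, gMap_a hp, apply_ite (gMap K p n _ _), gMap_a hp]
        simp)
      rw [h₀]
      exact zero_mem _
    · exact Submodule.mem_span_singleton_self _
    · have h₀ := sq (hMap K p n {2 * j, 2 * j + 1} 0) ((basisA K p n).ext fun i => by
        rw [basisA_eq, Module.End.mul_apply, hMap_a _ (even_card_pair j),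
          apply_ite (hMap K p n _ _), map_smul, hMap_a _ (even_card_pair j)]
        simp)
      rw [h₀]
      exact zero_mem _
  | zero => rw [zero_pow (by omega)]; exact zero_mem _
  | add x y hx hy h₁ h₂ =>
    rw [add_pow_char_of_commute p (ops_commute hp hx hy)]
    exact add_mem h₁ h₂
  | smul c x _ h =>
    rw [smul_pow]
    exact Submodule.smul_mem _ _ h

theorem pow_eq_zero_of_mem_ops [Fact p.Prime] [CharP K p] {e : Module.End K (A K p n)}
    (he : e ∈ ops K p n) : e ^ (2 * p) = 0 := by
  obtain ⟨c, hc⟩ := Submodule.mem_span_singleton.1 (pow_mem_span_of_mem_ops he)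
  have hp := (Fact.out : p.Prime).pos
  rw [mul_comm, pow_mul, ← hc, smul_pow, ← pow_mul, hMap_empty_pow_eq_zero (by omega), smul_zero]

theorem ops_apply_mem_fil [CharP K p] (hp : 2 ≤ p) {e : Module.End K (A K p n)}
    (he : e ∈ ops K p n) {i : ℕ} {x : A K p n} (hx : x ∈ fil K p n i) : e x ∈ fil K p n i := by
  have key : ∀ k σ s, i ≤ k → ∀ e ∈ ops K p n, e (a K p n k σ s) ∈ fil K p n i := by
    intro k σ s hk e he
    induction he using Submodule.span_induction with
    | mem f hf =>
      rcases hf with (rfl | rfl) | ⟨j, hj, rfl⟩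
      · rw [gMap_a hp]
        split_ifs
        · exact a_mem_fil hk _ _
        · exact zero_mem _
      · rw [hMap_a _ Even.zero]
        split_ifs
        · exact Submodule.smul_mem _ _ (a_mem_fil hk _ _)
        · exact zero_mem _
      · rw [hMap_a _ (even_card_pair j)]
        split_ifs
        · exact Submodule.smul_mem _ _ (a_mem_fil hk _ _)
        · exact zero_mem _
    | zero => exact zero_mem _
    | add x y _ _ hx hy => exact add_mem hx hy
    | smul c x _ hx => exact Submodule.smul_mem _ c hx
  induction hx using Submodule.span_induction with
  | mem x h =>
    obtain ⟨k, σ, s, hk, rfl⟩ := h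
    exact key k σ s hk e he
  | zero => simp
  | add x y _ _ hx hy => rw [map_add]; exact add_mem hx hy
  | smul c x _ hx => rw [map_smul]; exact Submodule.smul_mem _ c hx

/-- On the part of `A_n` with upper index `1`, an operator in the span acts as `ℓ + c g`, where `ℓ`
is a linear form in `h_{∅ 1}` and the `h_{{2j, 2j+1} 0}`. -/
theorem exists_linear_form_of_mem_ops [CharP K p] (hp : 2 ≤ p) {e : Module.End K (A K p n)}
    (he : e ∈ ops K p n) :
    ∃ (ℓ : MvPolynomial ℕ K) (c : K), ℓ.IsHomogeneous 1 ∧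
      (∀ F, e (emb K p n 1 ∅ F) = emb K p n 1 ∅ (ℓ * F) + c • emb K p n 1 {1} F) ∧
      ∀ F, e (emb K p n 1 {1} F) = emb K p n 1 {1} (ℓ * F) := by
  induction he using Submodule.span_induction with
  | mem f hf =>
    rcases hf with (rfl | rfl) | ⟨j, hj, rfl⟩
    · refine ⟨0, 1, MvPolynomial.isHomogeneous_zero _ _ _, fun F => ?_, fun F => ?_⟩
      · rw [gMap_emb_empty hp, zero_mul, map_zero, zero_add, one_smul]
      · rw [gMap_emb_singleton hp, zero_mul, map_zero]
    · refine ⟨MvPolynomial.X 0, 0, MvPolynomial.isHomogeneous_X _ _, fun F => ?_, fun F => ?_⟩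
      · rw [hMap_zero_emb, zero_smul, add_zero]
      · rw [hMap_zero_emb]
    · refine ⟨MvPolynomial.X j, 0, MvPolynomial.isHomogeneous_X _ _, fun F => ?_, fun F => ?_⟩
      · rw [hMap_pair_emb (Finset.empty_subset _) hj, zero_smul, add_zero]
      · rw [hMap_pair_emb subset_rfl hj]
  | zero => exact ⟨0, 0, MvPolynomial.isHomogeneous_zero _ _ _, by simp, by simp⟩
  | add x y _ _ hx hy =>
    obtain ⟨ℓ, c, h₁, h₂, h₃⟩ := hx
    obtain ⟨ℓ', c', h₁', h₂', h₃'⟩ := hy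
    refine ⟨ℓ + ℓ', c + c', h₁.add h₁', fun F => ?_, fun F => ?_⟩
    · rw [LinearMap.add_apply, h₂, h₂', add_mul, map_add, add_smul]
      abel
    · rw [LinearMap.add_apply, h₃, h₃', add_mul, map_add]
  | smul r x _ hx =>
    obtain ⟨ℓ, c, h₁, h₂, h₃⟩ := hx
    refine ⟨r • ℓ, r * c, ?_, fun F => ?_, fun F => ?_⟩
    · exact (MvPolynomial.homogeneousSubmodule ℕ K 1).smul_mem r h₁
    · rw [LinearMap.smul_apply, h₂, smul_mul_assoc, map_smul, smul_add, smul_smul]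
    · rw [LinearMap.smul_apply, h₃, smul_mul_assoc, map_smul]

/-- A product of more than `2pd` of `d` given operators contains one of them at least `2p` times. -/
theorem prod_eq_zero_of_mem_ops [Fact p.Prime] [CharP K p] {e : ℕ → Module.End K (A K p n)}
    (he : ∀ i, e i ∈ ops K p n) {d : ℕ} {l : List ℕ} (hl : ∀ i ∈ l, i < d)
    (hlen : 2 * p * d < l.length) : (l.map e).prod = 0 := by
  obtain ⟨i, hi⟩ : ∃ i, 2 * p ≤ l.count i := by
    by_contra! h
    have h₁ : l.toFinset.card ≤ d := by
      refine (Finset.card_le_card (t := Finset.range d) fun i hi => ?_).trans_eq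
        (Finset.card_range d)
      exact Finset.mem_range.2 (hl i (List.mem_toFinset.1 hi))
    have h₂ := Finset.sum_le_card_nsmul l.toFinset (fun i => l.count i) (2 * p) fun i _ => (h i).le
    rw [List.sum_toFinset_count_eq_length, smul_eq_mul, mul_comm] at h₂
    exact absurd (h₂.trans (Nat.mul_le_mul_left _ h₁)) (by omega)
  obtain ⟨l', hl'⟩ := (List.replicate_sublist_iff.2 hi).exists_perm_append
  have hc : (l.map e).Pairwise Commute := by
    refine List.pairwise_of_forall_mem_list fun x hx y hy => ?_
    obtain ⟨i, -, rfl⟩ := List.mem_map.1 hx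
    obtain ⟨j, -, rfl⟩ := List.mem_map.1 hy
    exact ops_commute (Fact.out : p.Prime).two_le (he i) (he j)
  rw [(hl'.map e).prod_eq' hc, List.map_append, List.prod_append, List.map_replicate,
    List.prod_replicate, pow_eq_zero_of_mem_ops (he i), zero_mul]

end Operators

/-! ### Elements of `C_n` -/

section Elements

variable {K : Type u} [Field K] {p n : ℕ} [Fact p.Prime] [CharP K p]

/-- The derivation part of an element of `B_n`, as an operator on `A_n`. -/
def rightOp (x : B K p n) : Module.End K (A K p n) := (x.right.1 : A K p n →ₗ[K] A K p n)

theorem lie_left (x y : B K p n) :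
    ⁅x, y⁆.left = mulA K p n x.left y.left + rightOp x y.left - rightOp y x.left := rfl

theorem lie_right_of_mem_ops {x y : B K p n} (hx : rightOp x ∈ ops K p n)
    (hy : rightOp y ∈ ops K p n) : ⁅x, y⁆.right = 0 := by
  refine Subtype.ext (LieDerivation.ext fun v => ?_)
  change rightOp x (rightOp y v) - rightOp y (rightOp x v) = 0
  rw [sub_eq_zero, ← Module.End.mul_apply, ← Module.End.mul_apply,
    ops_commute (Fact.out : p.Prime).two_le hx hy]

/-- In `C_n` the derivation part lies in the span of the generating operators, and the part of upper
index `1` in `A_n` is `a_{∅ 0}^{(1)} (F + G g)` with polynomials `F`, `G` in the `h`'s. -/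
theorem rightOp_mem_ops_and_left {m : ℕ+} {x : B K p m} (hx : x ∈ C K p m) :
    rightOp x ∈ ops K p m ∧
      ∃ F G, x.left - (emb K p m 1 ∅ F + emb K p m 1 {1} G) ∈ fil K p m 2 := by
  have hp := (Fact.out : p.Prime).two_le
  have key : ∀ x : B K p m, x.left = 0 → rightOp x ∈ ops K p m → rightOp x ∈ ops K p m ∧
      ∃ F G, x.left - (emb K p m 1 ∅ F + emb K p m 1 {1} G) ∈ fil K p m 2 :=
    fun x h₀ h => ⟨h, 0, 0, by rw [h₀]; simp⟩
  induction hx using LieSubalgebra.lieSpan_induction with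
  | mem x h =>
    rcases h with (rfl | rfl | rfl) | ⟨j, h₁, h₂, rfl⟩
    · refine ⟨zero_mem _, MvPolynomial.monomial 0 1, 0, ?_⟩
      rw [emb_monomial, if_pos (show IsReduced 0 from fun _ _ => Nat.zero_le _), pairs_zero]
      change a K p m 1 ∅ 0 - _ ∈ _
      simp
    · exact key _ rfl (Submodule.neg_mem _ (Submodule.subset_span (Or.inl (Or.inl rfl))))
    · exact key _ rfl (Submodule.neg_mem _ (Submodule.subset_span (Or.inl (Or.inr rfl))))
    · exact key _ rfl (Submodule.neg_mem _ (Submodule.subset_span (Or.inr ⟨j, h₁, rfl⟩)))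
  | zero => exact key _ rfl (zero_mem _)
  | add x y _ _ hx hy =>
    obtain ⟨hx, F, G, hFG⟩ := hx
    obtain ⟨hy, F', G', hFG'⟩ := hy
    refine ⟨add_mem hx hy, F + F', G + G', ?_⟩
    have := add_mem hFG hFG'
    rw [map_add, map_add]
    convert! this using 1
    change x.left + y.left - _ = _
    abel
  | smul r x _ hx =>
    obtain ⟨hx, F, G, hFG⟩ := hx
    refine ⟨Submodule.smul_mem _ r hx, r • F, r • G, ?_⟩
    have := Submodule.smul_mem _ r hFG
    rw [map_smul, map_smul]
    convert! this using 1
    change r • x.left - _ = _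
    rw [smul_sub, smul_add]
  | lie x y _ _ hx hy =>
    obtain ⟨hx, F, G, hFG⟩ := hx
    obtain ⟨hy, F', G', hFG'⟩ := hy
    refine ⟨?_, ?_⟩
    · have : rightOp ⁅x, y⁆ = 0 := by
        rw [rightOp, lie_right_of_mem_ops hx hy]
        rfl
      rw [this]
      exact zero_mem _
    obtain ⟨ℓ, c, -, h₁, h₂⟩ := exists_linear_form_of_mem_ops hp hx
    obtain ⟨ℓ', c', -, h₁', h₂'⟩ := exists_linear_form_of_mem_ops hp hy
    refine ⟨ℓ * F' - ℓ' * F, ℓ * G' + c • F' - (ℓ' * G + c' • F), ?_⟩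
    have e₁ := mulA_mem_fil le_rfl le_rfl (mem_fil_one x.left) (mem_fil_one y.left)
    have e₂ := ops_apply_mem_fil hp hx hFG'
    have e₃ := ops_apply_mem_fil hp hy hFG
    have := sub_mem (add_mem e₁ e₂) e₃
    rw [lie_left]
    convert! this using 1
    simp only [map_sub, map_add, map_smul, h₁, h₂, h₁', h₂']
    abel

end Elements

/-! ### Long commutators vanish -/

section Nilpotent

variable {K : Type u} [Field K] {p n : ℕ} [Fact p.Prime] [CharP K p]

theorem foldr_lie_left (v : ℕ → B K p n) (l : List ℕ) (y : B K p n) (hy : y.right = 0) :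
    l.foldr (fun i z => ⁅v i, z⁆) y =
      ⟨l.foldr (fun i z => mulA K p n (v i).left z + rightOp (v i) z) y.left, 0⟩ := by
  induction l with
  | nil => exact LieAlgebra.SemiDirectSum.ext rfl hy
  | cons i l ih =>
    rw [List.foldr_cons, List.foldr_cons, ih]
    refine LieAlgebra.SemiDirectSum.ext ?_ (lie_zero _)
    rw [lie_left]
    simp [rightOp]

/-- Modulo the next term of the filtration, only the derivation parts act. -/
theorem foldr_sub_prod_mem_fil {v : ℕ → B K p n} (hv : ∀ i, rightOp (v i) ∈ ops K p n) {j : ℕ}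
    (hj : 1 ≤ j) {x : A K p n} (hx : x ∈ fil K p n j) (l : List ℕ) :
    l.foldr (fun i z => mulA K p n (v i).left z + rightOp (v i) z) x ∈ fil K p n j ∧
      l.foldr (fun i z => mulA K p n (v i).left z + rightOp (v i) z) x -
        (l.map fun i => rightOp (v i)).prod x ∈ fil K p n (j + 1) := by
  have hp := (Fact.out : p.Prime).two_le
  have anti : ∀ y, y ∈ fil K p n (j + 1) → y ∈ fil K p n j := fun y hy =>
    Submodule.span_mono (by
      rintro z ⟨k, σ, s, h, e⟩
      exact ⟨k, σ, s, by omega, e⟩) hy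
  induction l with
  | nil => simpa using hx
  | cons i l ih =>
    rw [List.foldr_cons, List.map_cons, List.prod_cons, Module.End.mul_apply]
    set z := l.foldr (fun i z => mulA K p n (v i).left z + rightOp (v i) z) x
    have h₁ := mulA_mem_fil le_rfl hj (mem_fil_one (v i).left) ih.1
    rw [add_comm 1 j] at h₁
    refine ⟨add_mem (anti _ h₁) (ops_apply_mem_fil hp (hv i) ih.1), ?_⟩
    rw [add_sub_assoc, ← map_sub]
    exact add_mem h₁ (ops_apply_mem_fil hp (hv i) ih.2)

/-- Every block of `2pd + 1` letters raises the filtration degree by one. -/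
theorem foldr_mem_fil {v : ℕ → B K p n} (hv : ∀ i, rightOp (v i) ∈ ops K p n) {d : ℕ} (m : ℕ)
    (x : A K p n) (l : List ℕ) (hl : ∀ i ∈ l, i < d) (hlen : m * (2 * p * d + 1) ≤ l.length) :
    l.foldr (fun i z => mulA K p n (v i).left z + rightOp (v i) z) x ∈ fil K p n (m + 1) := by
  induction m generalizing l with
  | zero => exact mem_fil_one _
  | succ m ih =>
    have h₁ : (l.take (2 * p * d + 1)).length = 2 * p * d + 1 := by
      rw [List.length_take]
      rw [Nat.succ_mul] at hlen
      omega
    have h₂ := ih (l.drop (2 * p * d + 1)) (fun i hi => hl i (List.mem_of_mem_drop hi)) (by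
      rw [List.length_drop]
      rw [Nat.succ_mul] at hlen
      omega)
    rw [← List.take_append_drop (2 * p * d + 1) l, List.foldr_append]
    have h₃ := (foldr_sub_prod_mem_fil hv (by omega) h₂ (l.take (2 * p * d + 1))).2
    rwa [prod_eq_zero_of_mem_ops hv (fun i hi => hl i (List.mem_of_mem_take hi)) (by omega),
      LinearMap.zero_apply, sub_zero] at h₃

/-- Uniformly in `m`, long commutators in `d` elements of `C_m` vanish. -/
theorem foldr_lie_eq_zero {m : ℕ+} (v : ℕ → C K p m) {d : ℕ} (i j : ℕ) (l : List ℕ)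
    (hl : ∀ i ∈ l, i < d) (hlen : p * (2 * p * d + 1) ≤ l.length) :
    l.foldr (fun i z => ⁅v i, z⁆) ⁅v i, v j⁆ = 0 := by
  have hv : ∀ i, rightOp (v i : B K p m) ∈ ops K p m := fun i => (rightOp_mem_ops_and_left (v i).2).1
  have h : ∀ y : C K p m, ((l.foldr (fun i z => ⁅v i, z⁆) y : C K p m) : B K p m) =
      l.foldr (fun i z => ⁅(v i : B K p m), z⁆) (y : B K p m) := by
    intro y
    clear hl hlen
    induction l with
    | nil => rfl
    | cons i l ih => rw [List.foldr_cons, List.foldr_cons, LieSubalgebra.coe_bracket, ih]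
  refine Subtype.ext ((h _).trans ?_)
  rw [LieSubalgebra.coe_bracket, foldr_lie_left (fun i => (v i : B K p m)) _ _
    (lie_right_of_mem_ops (hv i) (hv j)),
    eq_zero_of_mem_fil (Nat.lt_succ_self p)
      (foldr_mem_fil (v := fun i => (v i : B K p m)) hv p _ l hl hlen)]
  rfl

end Nilpotent

end Drensky

/-! ### Local finiteness -/

section LocallyFinite

variable {K : Type u} [Field K]

/-- A Lie algebra is spanned by the right-normed commutators in its generators. -/
theorem span_foldr_lie_eq_top {L : Type*} [LieRing L] [LieAlgebra K L] {ι : Type*} (u : ι → L)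
    (hu : LieSubalgebra.lieSpan K L (Set.range u) = ⊤) :
    Submodule.span K {x | ∃ (l : List ι) (j : ι), x = l.foldr (fun i z => ⁅u i, z⁆) (u j)} = ⊤ := by
  set V := Submodule.span K {x | ∃ (l : List ι) (j : ι), x = l.foldr (fun i z => ⁅u i, z⁆) (u j)}
  have hV : ∀ x : L, ∀ y ∈ V, ⁅x, y⁆ ∈ V := by
    intro x
    have hx : x ∈ LieSubalgebra.lieSpan K L (Set.range u) := hu ▸ LieSubalgebra.mem_top x
    induction hx using LieSubalgebra.lieSpan_induction with
    | mem x h =>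
      obtain ⟨i, rfl⟩ := h
      intro y hy
      induction hy using Submodule.span_induction with
      | mem y hy =>
        obtain ⟨l, j, rfl⟩ := hy
        exact Submodule.subset_span ⟨i :: l, j, rfl⟩
      | zero => rw [lie_zero]; exact zero_mem _
      | add y z _ _ hy hz => rw [lie_add]; exact add_mem hy hz
      | smul c y _ hy => rw [lie_smul]; exact Submodule.smul_mem _ c hy
    | zero => intro y _; rw [zero_lie]; exact zero_mem _
    | add x z _ _ hx hz => intro y hy; rw [add_lie]; exact add_mem (hx y hy) (hz y hy)
    | smul c x _ hx => intro y hy; rw [smul_lie]; exact Submodule.smul_mem _ c (hx y hy)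
    | lie x z _ _ hx hz =>
      intro y hy
      rw [lie_lie]
      exact sub_mem (hx _ (hz y hy)) (hz _ (hx y hy))
  let V' : LieSubalgebra K L := { V with lie_mem' := fun {x y} _ hy => hV x y hy }
  have h : LieSubalgebra.lieSpan K L (Set.range u) ≤ V' := by
    rw [LieSubalgebra.lieSpan_le]
    rintro _ ⟨j, rfl⟩
    exact Submodule.subset_span ⟨[], j, rfl⟩
  rw [hu] at h
  exact eq_top_iff.2 fun x _ => h (LieSubalgebra.mem_top x)

theorem finiteDimensional_of_foldr_lie_eq_zero {L : Type*} [LieRing L] [LieAlgebra K L]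
    {ι : Type*} [Finite ι] (u : ι → L) (hu : LieSubalgebra.lieSpan K L (Set.range u) = ⊤) (N : ℕ)
    (h : ∀ (l : List ι) (i j : ι), N ≤ l.length →
      l.foldr (fun i z => ⁅u i, z⁆) ⁅u i, u j⁆ = 0) :
    FiniteDimensional K L := by
  have hfin : (⋃ j : ι, (fun l : List ι => l.foldr (fun i z => ⁅u i, z⁆) (u j)) ''
      {l | l.length ≤ N}).Finite :=
    Set.finite_iUnion fun j => (List.finite_length_le ι N).image _
  refine Module.finite_def.2 ((Submodule.fg_def).2 ⟨_, hfin, ?_⟩)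
  rw [eq_top_iff, ← span_foldr_lie_eq_top u hu, Submodule.span_le]
  rintro _ ⟨l, j, rfl⟩
  by_cases hl : l.length ≤ N
  · exact Submodule.subset_span (Set.mem_iUnion.2 ⟨j, l, hl, rfl⟩)
  · rcases List.eq_nil_or_concat l with rfl | ⟨l', i, rfl⟩
    · simp at hl
    · rw [List.concat_eq_append, List.foldr_append, List.foldr_cons, List.foldr_nil, h]
      · exact zero_mem _
      · simp at hl
        omega

theorem FreeLieAlgebra.lift_foldr_lie {L : Type*} [LieRing L] [LieAlgebra K L] (v : ℕ → L)
    (l : List ℕ) (x : FreeLieAlgebra K ℕ) :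
    FreeLieAlgebra.lift K v (l.foldr (fun i z => ⁅FreeLieAlgebra.of K i, z⁆) x) =
      l.foldr (fun i z => ⁅v i, z⁆) (FreeLieAlgebra.lift K v x) := by
  induction l with
  | nil => rfl
  | cons i l ih =>
    rw [List.foldr_cons, List.foldr_cons, LieHom.map_lie, ih, FreeLieAlgebra.lift_of_apply]

theorem Drensky.isLocallyFinite_W (p : ℕ) [Fact p.Prime] [CharP K p] (enum : ℕ+ ≃ ℚ) (α : ℝ) :
    (Drensky.W K p enum α).IsLocallyFinite := by
  rintro L _ _ hL ⟨S, hS⟩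
  set d := S.card
  set u : Fin d → L := fun i => S.equivFin.symm i
  have hu : Set.range u = S := by
    rw [show u = Subtype.val ∘ S.equivFin.symm from rfl, Set.range_comp,
      S.equivFin.symm.range_eq_univ]
    simp
  refine finiteDimensional_of_foldr_lie_eq_zero u (hu.symm ▸ hS) (p * (2 * p * d + 1))
    fun l i j hl => ?_
  set v : ℕ → L := fun i => if h : i < d then u ⟨i, h⟩ else 0
  have hv : ∀ i : Fin d, v i = u i := fun i => dif_pos i.2
  have key := hL ((l.map Fin.val).foldr (fun i z => ⁅FreeLieAlgebra.of K i, z⁆)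
    ⁅FreeLieAlgebra.of K (i : ℕ), FreeLieAlgebra.of K (j : ℕ)⁆) (fun r v => by
      rw [FreeLieAlgebra.lift_foldr_lie, LieHom.map_lie, FreeLieAlgebra.lift_of_apply,
        FreeLieAlgebra.lift_of_apply]
      refine Drensky.foldr_lie_eq_zero (d := d) v _ _ _ (fun i hi => ?_) ?_
      · obtain ⟨k, -, rfl⟩ := List.mem_map.1 hi
        exact k.2
      · rwa [List.length_map]) v
  rw [FreeLieAlgebra.lift_foldr_lie, LieHom.map_lie, FreeLieAlgebra.lift_of_apply,
    FreeLieAlgebra.lift_of_apply, hv, hv, List.foldr_map] at key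
  simpa only [hv] using key

end LocallyFinite

namespace Drensky

/-! ### The separating identities -/

section Separating

/-- The left-normed commutator `[[x, y], z₀, …, z_{m-1}]`. -/
def separatorHead {L : Type*} [LieRing L] (x y : L) (z : ℕ → L) : ℕ → L
  | 0 => ⁅x, y⁆
  | m + 1 => ⁅separatorHead x y z m, z m⁆

/-- The left-normed commutator `[[x, y], z₀, …, z_{m-1}, [x, y], …, [x, y]]` in which `i` copies of
`[x, y]` follow the `z`'s. -/
def separator {L : Type*} [LieRing L] (x y : L) (z : ℕ → L) (m : ℕ) : ℕ → L
  | 0 => separatorHead x y z m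
  | i + 1 => ⁅separator x y z m i, ⁅x, y⁆⁆

theorem map_separatorHead {K L M : Type*} [CommRing K] [LieRing L] [LieAlgebra K L] [LieRing M]
    [LieAlgebra K M] (f : L →ₗ⁅K⁆ M) (x y : L) (z : ℕ → L) (m : ℕ) :
    f (separatorHead x y z m) = separatorHead (f x) (f y) (fun i => f (z i)) m := by
  induction m with
  | zero => exact f.map_lie x y
  | succ m ih => rw [separatorHead, separatorHead, LieHom.map_lie, ih]

theorem map_separator {K L M : Type*} [CommRing K] [LieRing L] [LieAlgebra K L] [LieRing M]
    [LieAlgebra K M] (f : L →ₗ⁅K⁆ M) (x y : L) (z : ℕ → L) (m i : ℕ) :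
    f (separator x y z m i) = separator (f x) (f y) (fun i => f (z i)) m i := by
  induction i with
  | zero => exact map_separatorHead f x y z m
  | succ i ih => rw [separator, separator, LieHom.map_lie, LieHom.map_lie, ih]

variable {K : Type u} [Field K]

/-- For operators `ℓ i + c i • g` with `g ^ 2 = 0`, the product of the first `m` of their negatives
is `P + Q g`, where `(P, Q)` is the value of this function at `m`. -/
noncomputable def formProd (ℓ : ℕ → MvPolynomial ℕ K) (c : ℕ → K) :
    ℕ → MvPolynomial ℕ K × MvPolynomial ℕ K
  | 0 => (1, 0)
  | m + 1 => (-(ℓ m * (formProd ℓ c m).1),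
      -(ℓ m * (formProd ℓ c m).2 + c m • (formProd ℓ c m).1))

theorem formProd_isHomogeneous {ℓ : ℕ → MvPolynomial ℕ K} (hℓ : ∀ i, (ℓ i).IsHomogeneous 1)
    (c : ℕ → K) (m : ℕ) :
    (formProd ℓ c m).1.IsHomogeneous m ∧ (formProd ℓ c (m + 1)).2.IsHomogeneous m := by
  induction m with
  | zero =>
    refine ⟨MvPolynomial.isHomogeneous_one _ _, ?_⟩
    simp only [formProd, mul_zero, zero_add]
    exact ((MvPolynomial.homogeneousSubmodule ℕ K 0).smul_mem _
      (MvPolynomial.isHomogeneous_one _ _)).neg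
  | succ m ih =>
    have h₁ : (formProd ℓ c (m + 1)).1.IsHomogeneous (m + 1) := by
      rw [formProd, add_comm m 1]
      exact ((hℓ m).mul ih.1).neg
    refine ⟨h₁, ?_⟩
    rw [formProd]
    refine MvPolynomial.IsHomogeneous.neg (MvPolynomial.IsHomogeneous.add ?_ ?_)
    · have := (hℓ (m + 1)).mul ih.2
      rwa [add_comm 1 m] at this
    · exact (MvPolynomial.homogeneousSubmodule ℕ K (m + 1)).smul_mem _ h₁

variable {p n : ℕ} [Fact p.Prime] [CharP K p]

/-- If `[x, y]` has the coordinates `R + S g`, then `[[x, y], z₀, …, z_{m-1}]` has the coordinates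
`(P + Q g) (R + S g)`, where `P + Q g` is the product of the operators by which the `z`'s act on the
right. -/
theorem separatorHead_left {x y : B K p n} {z : ℕ → B K p n}
    (hxy : (⁅x, y⁆ : B K p n).right = 0) (hz : ∀ i, rightOp (z i) ∈ ops K p n)
    {R S : MvPolynomial ℕ K}
    (hw : (⁅x, y⁆ : B K p n).left - (emb K p n 1 ∅ R + emb K p n 1 {1} S) ∈ fil K p n 2)
    {ℓ : ℕ → MvPolynomial ℕ K} {c : ℕ → K}
    (h₁ : ∀ i F, rightOp (z i) (emb K p n 1 ∅ F) =
      emb K p n 1 ∅ (ℓ i * F) + c i • emb K p n 1 {1} F)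
    (h₂ : ∀ i F, rightOp (z i) (emb K p n 1 {1} F) = emb K p n 1 {1} (ℓ i * F)) (m : ℕ) :
    (separatorHead x y z m).right = 0 ∧
      (separatorHead x y z m).left - (emb K p n 1 ∅ ((formProd ℓ c m).1 * R) +
        emb K p n 1 {1} ((formProd ℓ c m).1 * S + (formProd ℓ c m).2 * R)) ∈ fil K p n 2 := by
  have hp := (Fact.out : p.Prime).two_le
  induction m with
  | zero =>
    refine ⟨hxy, ?_⟩
    simpa [formProd, separatorHead] using hw
  | succ m ih =>
    obtain ⟨hr, hl⟩ := ih
    have h0 : rightOp (separatorHead x y z m) = 0 := by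
      rw [rightOp, hr]
      rfl
    refine ⟨lie_right_of_mem_ops (h0 ▸ zero_mem _) (hz m), ?_⟩
    rw [separatorHead, lie_left, h0, LinearMap.zero_apply, add_zero]
    have e₁ := mulA_mem_fil le_rfl le_rfl (mem_fil_one (separatorHead x y z m).left)
      (mem_fil_one (z m).left)
    have e₂ := ops_apply_mem_fil hp (hz m) hl
    convert! sub_mem e₁ e₂ using 1
    simp only [map_sub, map_add, h₁, h₂, formProd, neg_mul, add_mul, mul_assoc, map_neg,
      smul_mul_assoc, map_smul]
    abel

/-- The terms `F S` and `G R` of the first product, for `F = P R` and `G = P S + Q R`, cancel up to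
`Q R²`, so that the value depends on `R` and `Q` only. -/
theorem separator_left {x y : B K p n} {z : ℕ → B K p n}
    (hxy : (⁅x, y⁆ : B K p n).right = 0) (hz : ∀ i, rightOp (z i) ∈ ops K p n)
    {R S : MvPolynomial ℕ K}
    (hw : (⁅x, y⁆ : B K p n).left - (emb K p n 1 ∅ R + emb K p n 1 {1} S) ∈ fil K p n 2)
    {ℓ : ℕ → MvPolynomial ℕ K} {c : ℕ → K}
    (h₁ : ∀ i F, rightOp (z i) (emb K p n 1 ∅ F) =
      emb K p n 1 ∅ (ℓ i * F) + c i • emb K p n 1 {1} F)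
    (h₂ : ∀ i F, rightOp (z i) (emb K p n 1 {1} F) = emb K p n 1 {1} (ℓ i * F)) (m i : ℕ) :
    (separator x y z m (i + 1)).right = 0 ∧
      (separator x y z m (i + 1)).left -
        (-1 : K) ^ (i + 1) • emb K p n (i + 2) {1} ((formProd ℓ c m).2 * R ^ (i + 2)) ∈
          fil K p n (i + 3) := by
  have hw0 : rightOp (⁅x, y⁆ : B K p n) = 0 := by
    rw [rightOp, hxy]
    rfl
  induction i with
  | zero =>
    obtain ⟨hr, hl⟩ := separatorHead_left hxy hz hw h₁ h₂ m
    have h0 : rightOp (separatorHead x y z m) = 0 := by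
      rw [rightOp, hr]
      rfl
    refine ⟨lie_right_of_mem_ops (h0 ▸ zero_mem _) (hw0 ▸ zero_mem _), ?_⟩
    rw [separator, separator, lie_left, h0, hw0, LinearMap.zero_apply, LinearMap.zero_apply,
      add_zero, sub_zero]
    set P := (formProd ℓ c m).1
    set Q := (formProd ℓ c m).2
    set u := (separatorHead x y z m).left
    set w := (⁅x, y⁆ : B K p n).left
    set u' := emb K p n 1 ∅ (P * R) + emb K p n 1 {1} (P * S + Q * R) with hu'
    set w' := emb K p n 1 ∅ R + emb K p n 1 {1} S with hw'
    have e₁ := mulA_mem_fil (by omega) le_rfl hl (mem_fil_one w)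
    have e₂ := mulA_mem_fil le_rfl (by omega) (mem_fil_one u') hw
    have e₃ : mulA K p n u' w' = (-1 : K) ^ (0 + 1) • emb K p n (0 + 2) {1} (Q * R ^ (0 + 2)) := by
      rw [hu', hw', map_add, map_add, LinearMap.add_apply, LinearMap.add_apply, mulA_emb_empty,
        mulA_emb_emb le_rfl, mulA_emb_singleton le_rfl le_rfl, mulA_skew (emb K p n 1 {1} _),
        mulA_emb_emb le_rfl, zero_add, add_zero, ← map_neg, ← map_add, pow_one, neg_one_smul,
        ← map_neg]
      congr 1
      ring
    convert! add_mem e₁ e₂ using 1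
    rw [← e₃]
    simp only [map_sub, LinearMap.sub_apply]
    abel
  | succ i ih =>
    obtain ⟨hr, hl⟩ := ih
    have h0 : rightOp (separator x y z m (i + 1)) = 0 := by
      rw [rightOp, hr]
      rfl
    refine ⟨lie_right_of_mem_ops (h0 ▸ zero_mem _) (hw0 ▸ zero_mem _), ?_⟩
    rw [separator, lie_left, h0, hw0, LinearMap.zero_apply, LinearMap.zero_apply, add_zero,
      sub_zero]
    set Q := (formProd ℓ c m).2
    set u := (separator x y z m (i + 1)).left
    set w := (⁅x, y⁆ : B K p n).left
    set u' := emb K p n (i + 2) {1} (Q * R ^ (i + 2)) with hu'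
    set w' := emb K p n 1 ∅ R + emb K p n 1 {1} S with hw'
    have e₁ := mulA_mem_fil (by omega) le_rfl hl (mem_fil_one w)
    have e₂ := mulA_mem_fil (by omega) (by omega)
      (emb_mem_fil (le_refl (i + 2)) {1} (Q * R ^ (i + 2))) hw
    rw [← hu'] at e₂
    have e₃ : mulA K p n u' w' = -emb K p n (i + 3) {1} (Q * R ^ (i + 3)) := by
      rw [hu', hw', map_add, mulA_emb_singleton (by omega) le_rfl, mulA_skew,
        mulA_emb_emb (by omega), add_zero]
      congr 2
      ring
    convert! add_mem e₁ (Submodule.smul_mem _ ((-1 : K) ^ (i + 1)) e₂) using 1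
    rw [pow_succ, mul_neg_one, neg_smul, ← smul_neg, ← e₃]
    simp only [map_sub, LinearMap.sub_apply, map_smul, LinearMap.smul_apply, smul_sub]
    abel

/-- With `p - 1` copies of `[x, y]` at the end, everything except the leading term vanishes. -/
theorem separator_eq {x y : B K p n} {z : ℕ → B K p n}
    (hxy : (⁅x, y⁆ : B K p n).right = 0) (hz : ∀ i, rightOp (z i) ∈ ops K p n)
    {R S : MvPolynomial ℕ K}
    (hw : (⁅x, y⁆ : B K p n).left - (emb K p n 1 ∅ R + emb K p n 1 {1} S) ∈ fil K p n 2)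
    {ℓ : ℕ → MvPolynomial ℕ K} {c : ℕ → K}
    (h₁ : ∀ i F, rightOp (z i) (emb K p n 1 ∅ F) =
      emb K p n 1 ∅ (ℓ i * F) + c i • emb K p n 1 {1} F)
    (h₂ : ∀ i F, rightOp (z i) (emb K p n 1 {1} F) = emb K p n 1 {1} (ℓ i * F)) (m : ℕ) :
    separator x y z m (p - 1) =
      ⟨(-1 : K) ^ (p - 1) • emb K p n p {1} ((formProd ℓ c m).2 * R ^ p), 0⟩ := by
  obtain ⟨q, hq⟩ := Nat.exists_eq_add_of_le' (Fact.out : p.Prime).two_le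
  obtain ⟨hr, hl⟩ := separator_left hxy hz hw h₁ h₂ m q
  have h := eq_zero_of_mem_fil (by omega) hl
  rw [show p - 1 = q + 1 by omega]
  refine LieAlgebra.SemiDirectSum.ext ((sub_eq_zero.1 h).trans ?_) hr
  rw [← hq]

/-- Only the coefficient of `X 0` in `R` matters for `R ^ p`, and `X 0 ^ p * Q` has a monomial that
survives in the top layer only if the degree of `Q` is `n - 1`. -/
theorem emb_top_mul_pow_eq_zero (hn : 1 ≤ n) {Q R : MvPolynomial ℕ K} {q : ℕ}
    (hQ : Q.IsHomogeneous q) (hR : MvPolynomial.coeff 0 R = 0) (hq : q + 1 ≠ n) :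
    emb K p n p {1} (Q * R ^ p) = 0 := by
  have hp := (Fact.out : p.Prime).two_le
  -- The Frobenius map turns `R ^ p` into a sum of `p`-th powers of monomials.
  rw [R.as_sum, sum_pow_char, Finset.mul_sum, map_sum]
  refine Finset.sum_eq_zero fun ν hν => ?_
  rw [Q.as_sum, Finset.sum_mul, map_sum]
  refine Finset.sum_eq_zero fun μ hμ => ?_
  rw [MvPolynomial.monomial_pow, MvPolynomial.monomial_mul, ← mul_one (_ * _),
    ← smul_eq_mul, ← MvPolynomial.smul_monomial, map_smul]
  convert! smul_zero _
  by_contra h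
  obtain ⟨h₁, h₂, h₃⟩ := emb_top_monomial hn h
  simp only [Finsupp.add_apply, Finsupp.smul_apply, smul_eq_mul] at h₁ h₂ h₃
  have hν' : ν ≠ 0 := by
    rintro rfl
    exact (MvPolynomial.mem_support_iff.1 hν) hR
  -- A surviving monomial `ν` of `R` can only be `X 0`: the pairs may not repeat.
  have hνj : ∀ j, 1 ≤ j → ν j = 0 := by
    intro j hj
    by_contra hne
    have : p * 1 ≤ p * ν j := Nat.mul_le_mul_left p (by omega)
    have := h₂ j hj
    have := h₃ j
    omega
  have hν0 : ν 0 ≠ 0 := fun h0 => hν' <| Finsupp.ext fun j => by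
    rcases Nat.eq_zero_or_pos j with rfl | hj
    · exact h0
    · exact hνj j hj
  -- Since `X 0 ^ p` already exhausts the lower index, `μ` may not contain `X 0`.
  have hμ0 : μ 0 = 0 := by
    have : p * 1 ≤ p * ν 0 := Nat.mul_le_mul_left p (by omega)
    omega
  have hdeg : μ.degree = q := by
    by_contra hne
    exact (MvPolynomial.mem_support_iff.1 hμ) (hQ.coeff_eq_zero hne)
  have hdeg' : μ.degree = ∑ j ∈ Finset.Ico 1 n, μ j := by
    refine Finset.sum_subset (fun j hj => ?_) fun j _ hj => by simpa using hj
    rw [Finsupp.mem_support_iff] at hj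
    rw [Finset.mem_Ico]
    have := h₃ j
    by_contra hne
    have : j = 0 := by omega
    rw [this] at hj
    exact hj hμ0
  rw [Finset.sum_congr rfl (g := fun _ => 1) fun j hj => ?_] at hdeg'
  · simp at hdeg'
    omega
  · rw [Finset.mem_Ico] at hj
    have := h₂ j hj.1 hj.2
    rw [hνj j hj.1, mul_zero, add_zero] at this
    exact this

/-- The separator with `m` elements `z` is an identity of `C_k` for `k ≠ m`: the polynomial `R` of
`[x, y]` has no constant term, and the factor `Q` attached to the `z`'s has degree `m - 1`. -/
theorem separator_eq_zero {k m : ℕ+} (hkm : k ≠ m) (x y : C K p k) (z : ℕ → C K p k) :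
    separator x y z m (p - 1) = 0 := by
  have hp := (Fact.out : p.Prime).two_le
  obtain ⟨hx, F, G, hFG⟩ := rightOp_mem_ops_and_left x.2
  obtain ⟨hy, F', G', hFG'⟩ := rightOp_mem_ops_and_left y.2
  have hz : ∀ i, rightOp (z i : B K p k) ∈ ops K p k := fun i => (rightOp_mem_ops_and_left (z i).2).1
  obtain ⟨ℓx, cx, hℓx, hx₁, hx₂⟩ := exists_linear_form_of_mem_ops hp hx
  obtain ⟨ℓy, cy, hℓy, hy₁, hy₂⟩ := exists_linear_form_of_mem_ops hp hy
  choose ℓ c hℓ h₁ h₂ using fun i => exists_linear_form_of_mem_ops hp (hz i)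
  have hw : (⁅(x : B K p k), (y : B K p k)⁆ : B K p k).left -
      (emb K p k 1 ∅ (ℓx * F' - ℓy * F) +
        emb K p k 1 {1} (ℓx * G' + cx • F' - (ℓy * G + cy • F))) ∈ fil K p k 2 := by
    have e₁ := mulA_mem_fil le_rfl le_rfl (mem_fil_one (x : B K p k).left)
      (mem_fil_one (y : B K p k).left)
    have e₂ := ops_apply_mem_fil hp hx hFG'
    have e₃ := ops_apply_mem_fil hp hy hFG
    rw [lie_left]
    convert! sub_mem (add_mem e₁ e₂) e₃ using 1
    simp only [map_sub, map_add, map_smul, hx₁, hx₂, hy₁, hy₂]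
    abel
  have h := separator_eq (lie_right_of_mem_ops hx hy) hz hw h₁ h₂ m
  have h0 : ∀ f : MvPolynomial ℕ K, f.IsHomogeneous 1 → MvPolynomial.coeff 0 f = 0 :=
    fun f hf => hf.coeff_eq_zero (by simp)
  obtain ⟨q, hq⟩ := Nat.exists_eq_add_of_le' m.pos
  rw [emb_top_mul_pow_eq_zero (q := q) k.pos] at h
  · refine Subtype.ext (((map_separator (C K p k).incl x y z m (p - 1))).trans (h.trans ?_))
    rw [smul_zero]
    rfl
  · rw [hq]
    exact (formProd_isHomogeneous hℓ c q).2
  · rw [← MvPolynomial.constantCoeff_eq, map_sub, map_mul, map_mul, MvPolynomial.constantCoeff_eq]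
    simp only [h0 _ hℓx, h0 _ hℓy, zero_mul, sub_zero]
  · intro h
    exact hkm (PNat.coe_injective (by omega))

/-- The value at `x = a_{∅ 0}^{(1)}`, `y = h_{∅ 1}`, `z₀ = g_{{1} 0}` and `z_j = h_{{2j, 2j+1} 0}` for
`1 ≤ j < m` is `± a_{σ p}^{(p)}` with `σ = {1, …, 2m-1}`. -/
theorem exists_separator_ne_zero (m : ℕ+) :
    ∃ (x y : C K p m) (z : ℕ → C K p m), separator x y z m (p - 1) ≠ 0 := by
  have hp := (Fact.out : p.Prime).two_le
  let x : C K p m := ⟨aB K p m 1 ∅ 0, LieSubalgebra.subset_lieSpan (Or.inl (Or.inl rfl))⟩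
  let y : C K p m := ⟨_, LieSubalgebra.subset_lieSpan (Or.inl (Or.inr (Or.inr rfl)))⟩
  let g : C K p m := ⟨_, LieSubalgebra.subset_lieSpan (Or.inl (Or.inr (Or.inl rfl)))⟩
  let z : ℕ → C K p m := fun i =>
    if h₁ : 1 ≤ i then
      if h₂ : i < m then ⟨_, LieSubalgebra.subset_lieSpan (Or.inr ⟨i, h₁, h₂, rfl⟩)⟩ else 0
    else g
  let ℓ : ℕ → MvPolynomial ℕ K := fun i => if 1 ≤ i ∧ i < m then -MvPolynomial.X i else 0
  let c : ℕ → K := fun i => if 1 ≤ i then 0 else -1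
  refine ⟨x, y, z, fun h => ?_⟩
  have hx : rightOp (x : B K p m) = 0 := rfl
  have hy : rightOp (y : B K p m) = -hMap K p m ∅ 1 := rfl
  have hz : ∀ i, rightOp (z i : B K p m) ∈ ops K p m := fun i => (rightOp_mem_ops_and_left (z i).2).1
  have hxl : (x : B K p m).left = emb K p m 1 ∅ (MvPolynomial.monomial 0 1) := by
    rw [emb_monomial, if_pos (show IsReduced 0 from fun _ _ => Nat.zero_le _), pairs_zero]
    rfl
  have hw : (⁅(x : B K p m), (y : B K p m)⁆ : B K p m).left =
      emb K p m 1 ∅ (MvPolynomial.X 0) := by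
    rw [lie_left, hx, hy, hxl, LinearMap.neg_apply, hMap_zero_emb]
    change mulA K p m _ 0 + 0 - _ = _
    simp
  have hzi : ∀ i, rightOp (z i : B K p m) =
      if 1 ≤ i then if i < m then -hMap K p m {2 * i, 2 * i + 1} 0 else 0
      else -gMap K p m {1} 0 := by
    intro i
    simp only [z]
    split_ifs <;> rfl
  have h₁ : ∀ i F, rightOp (z i : B K p m) (emb K p m 1 ∅ F) =
      emb K p m 1 ∅ (ℓ i * F) + c i • emb K p m 1 {1} F := by
    intro i F
    rw [hzi]
    by_cases hi : 1 ≤ i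
    · by_cases him : i < m
      · simp [hi, him, ℓ, c, hMap_pair_emb (Finset.empty_subset _) hi]
      · simp [hi, him, ℓ, c]
    · simp [hi, ℓ, c, gMap_emb_empty hp]
  have h₂ : ∀ i F, rightOp (z i : B K p m) (emb K p m 1 {1} F) = emb K p m 1 {1} (ℓ i * F) := by
    intro i F
    rw [hzi]
    by_cases hi : 1 ≤ i
    · by_cases him : i < m
      · simp [hi, him, ℓ, hMap_pair_emb subset_rfl hi]
      · simp [hi, him, ℓ]
    · simp [hi, ℓ, gMap_emb_singleton hp]
  have hval := separator_eq (R := MvPolynomial.X 0) (S := 0) (lie_right_of_mem_ops (hx ▸ zero_mem _)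
    (rightOp_mem_ops_and_left y.2).1) hz (by rw [hw]; simp) h₁ h₂ m
  have hform : ∀ j : ℕ, j + 1 ≤ (m : ℕ) → formProd ℓ c (j + 1) =
      (0, MvPolynomial.monomial (∑ i ∈ Finset.Ico 1 (j + 1), Finsupp.single i 1) 1) := by
    intro j hj
    induction j with
    | zero => simp [formProd, ℓ, c]
    | succ j ih =>
      rw [formProd, ih (by omega), Finset.sum_Ico_succ_top (show 1 ≤ j + 1 by omega)]
      have : 1 ≤ j + 1 ∧ j + 1 < m := by omega
      simp only [ℓ, if_pos this, mul_zero, smul_zero, add_zero, neg_zero, neg_mul, neg_neg,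
        MvPolynomial.X, MvPolynomial.monomial_mul, mul_one]
      rw [add_comm]
  obtain ⟨q, hq⟩ := Nat.exists_eq_add_of_le' m.pos
  have hform' := hform q hq.ge
  rw [← hq] at hform'
  have hval' := (map_separator (C K p m).incl x y z m (p - 1)).symm.trans (congrArg _ h)
  replace hval' := congrArg LieAlgebra.SemiDirectSum.left (hval.symm.trans hval')
  change _ = (0 : A K p m) at hval'
  rw [smul_eq_zero_iff_right (pow_ne_zero _ (neg_ne_zero.2 one_ne_zero)), hform', MvPolynomial.X,
    MvPolynomial.monomial_pow, MvPolynomial.monomial_mul, one_pow, one_mul] at hval'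
  refine emb_top_ne_zero m.pos (by omega) ?_ (fun j hj hjm => ?_) (fun j hj => ?_) hval' <;>
    simp only [Finsupp.add_apply, Finsupp.finsetSum_apply, Finsupp.smul_apply,
      Finsupp.single_apply, Finset.sum_ite_eq', Finset.mem_Ico]
  · simp
  · rw [if_pos ⟨hj, hjm⟩, if_neg (by omega), smul_zero, add_zero]
  · have := m.pos
    rw [if_neg (by omega), if_neg (by omega), smul_zero, add_zero]

theorem exists_identity (m : ℕ+) :
    ∃ f : FreeLieAlgebra K ℕ, ¬IsLieIdentity K (C K p m) f ∧
      ∀ k : ℕ+, k ≠ m → IsLieIdentity K (C K p k) f := by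
  obtain ⟨x, y, z, h⟩ := exists_separator_ne_zero (K := K) (p := p) m
  refine ⟨separator (FreeLieAlgebra.of K 0) (FreeLieAlgebra.of K 1)
    (fun i => FreeLieAlgebra.of K (i + 2)) m (p - 1), fun hid => h ?_, fun k hk v => ?_⟩
  · let v : ℕ → C K p m := fun i => if i = 0 then x else if i = 1 then y else z (i - 2)
    have := hid v
    rw [map_separator] at this
    simp only [FreeLieAlgebra.lift_of_apply] at this
    exact this
  · rw [map_separator]
    exact separator_eq_zero hk _ _ _

theorem strictMono_W (enum : ℕ+ ≃ ℚ) : StrictMono (W K p enum) := by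
  intro α β hαβ
  refine lt_of_le_not_ge (fun M _ _ hM f hf => hM f fun r => hf ⟨r.1, r.2.trans hαβ.le⟩) fun h => ?_
  obtain ⟨r, hαr, hrβ⟩ := exists_rat_btwn hαβ
  obtain ⟨f, hf, hf'⟩ := exists_identity (K := K) (p := p) (enum.symm r)
  refine hf (h (L K p enum r) (fun f hf => hf ⟨r, hrβ.le⟩) f fun s => hf' _ fun e => ?_)
  have hs : (r : ℝ) ≤ α := enum.symm.injective e ▸ s.2
  exact absurd hs (not_le.2 hαr)

end Separating

end Drensky

theorem theorem2 (K : Type u) [Field K] (p : ℕ) [Fact p.Prime] [CharP K p] (enum : ℕ+ ≃ ℚ) :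
    (∀ α : ℝ, (Drensky.W K p enum α).IsLocallyFinite) ∧
      StrictMono (Drensky.W K p enum) ∧
      Cardinal.mk (Set.range (Drensky.W K p enum)) = Cardinal.continuum := by
  refine ⟨Drensky.isLocallyFinite_W p enum, Drensky.strictMono_W enum, ?_⟩
  have h := Cardinal.mk_range_eq_of_injective (Drensky.strictMono_W (K := K) (p := p) enum).injective
  rwa [Cardinal.mk_real, Cardinal.lift_continuum, Cardinal.lift_id'] at h
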